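/- Theorem 2. Let $V\subset\mathbb{C}^4$ be a generic affine (complex) plane. Here generic means the following: let $L_0,\dots,L_3$ be the closures in $\bar V\cong\mathbb{C}P^2$ of the lines $\{z_j=0\}\subset V$ ($j=0,\dots,3$, where $z_0,\dots,z_3$ are the coordinates of $\mathbb{C}^4$), and let $L_\infty=\bar V\setminus V$; no three of these five lines have a common point, and on each of the five lines the cross-ratio of its four intersection points with the other lines is not real. (When planes are parametrized as $(u,v)\mapsto(m_{j0}u+m_{j1}v+m_{j2})_{j=0,\dots,3}$ with $(m_{ji})\in\mathbb{C}^{4\times3}\cong\mathbb{R}^{24}$, this condition holds outside the zero set of a non-zero real polynomial in the real and imaginary parts of the $m_{ji}$.) Put $V^\times=V\cap(\mathbb{C}^\times)^4$, and let $\mathcal{B}:V^\times\to(\mathbb{R}P^1)^4$, $\mathcal{B}(z)=([\mathrm{Re}\,z_j:\mathrm{Im}\,z_j])_{j=0,\dots,3}$, be the rolled coamoeba map. Let $Z\subset V^\times$ be the locus of its critical points (the points where its real differential is not surjective) and let $\mathcal{B}_Z=\mathcal{B}(Z)$ be its set of critical values, with the subspace topologies. Then there are a compact Hausdorff space $\hat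 Z$ which contains $Z$ as a dense subspace, a locally trivial circle bundle $\pi:\hat Z\to\mathcal{B}_Z$ with $\pi|_Z=\mathcal{B}|_Z$, and five pairwise different continuous sections $s_0,s_1,s_2,s_3,s_\infty$ of $\pi$ such that $Z$ is exactly the complement in $\hat Z$ of the union of the images of these sections. The sections are distinguished as follows: the inclusion $Z\subset\mathbb{C}^4\subset\mathbb{C}P^4$ extends to a continuous map $e:\hat Z\to\mathbb{C}P^4$, and the image of $s_j$ is the preimage under $e$ of the closure of the hyperplane $\{z_j=0\}$ for $j=0,\dots,3$, and of the hyperplane at infinity for $s_\infty$. (For the plane $(x,y)\mapsto(x,\,y,\,x+y-1,\,x+ky-a)$ the five sections are $s_0$: $x=0$; $s_p$: $y=0$; $s_1$: $x+y=1$; $s_a$: $x+ky=a$; and $s_\infty$: the points at infinity.) -/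

import Mathlib

open scoped LinearAlgebra.Projectivization

noncomputable section

/-- The projective space of a topological vector space carries the quotient topology. -/
instance projectivizationTopology {K E : Type*} [DivisionRing K] [AddCommGroup E] [Module K E]
    [TopologicalSpace E] : TopologicalSpace (ℙ K E) :=
  TopologicalSpace.coinduced (Projectivization.mk' K) inferInstance

/-! ### Generic affine planes in `ℂ⁴` -/

/-- The affine subspace `{(M j 0 * u + M j 1 * v + M j 2)_j | u v : ℂ}` of `ℂ⁴`. Every affine plane
in `ℂ⁴` has this form. -/
def affinePlane (M : Matrix (Fin 4) (Fin 3) ℂ) : AffineSubspace ℂ (Fin 4 → ℂ) :=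
  AffineSubspace.mk' (fun j => M j 2)
    (Submodule.span ℂ {(fun j => M j 0 : Fin 4 → ℂ), fun j => M j 1})

/-- The five linear forms on `ℂ³`, in homogeneous coordinates `[u : v : w]`, which cut out five
lines in the projective closure `ℂP²` of the plane: for `j = 0, 1, 2, 3` the line where the `j`-th
coordinate of `ℂ⁴` vanishes, and for `j = 4` the line at infinity `w = 0`. -/
def lineForm (M : Matrix (Fin 4) (Fin 3) ℂ) : Fin 5 → Fin 3 → ℂ :=
  Fin.snoc (α := fun _ => Fin 3 → ℂ) (fun j => M j) ![0, 0, 1]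

/-- The determinant of three of the five linear forms; it vanishes iff the three lines have a
common point (or two of them agree, or a form is zero). -/
def bracket (M : Matrix (Fin 4) (Fin 3) ℂ) (i j k : Fin 5) : ℂ :=
  Matrix.det (Matrix.of ![lineForm M i, lineForm M j, lineForm M k])

/-- The cross-ratio, on the line number `m`, of its intersection points with the lines number
`i`, `j`, `k`, `l`. -/
def lineCrossRatio (M : Matrix (Fin 4) (Fin 3) ℂ) (m i j k l : Fin 5) : ℂ :=
  (bracket M m i k * bracket M m j l) / (bracket M m i l * bracket M m j k)

/-- `V` is an affine plane such that the four coordinate lines of `V` and its line at infinity are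
in general position (no three of the five have a common point), and, on each of these five lines,
the four intersection points with the others have a non-real cross-ratio, that is, they do not lie
on a common circle. -/
def IsGenericPlane (V : AffineSubspace ℂ (Fin 4 → ℂ)) : Prop :=
  Module.finrank ℂ V.direction = 2 ∧
  ∃ M : Matrix (Fin 4) (Fin 3) ℂ, V = affinePlane M ∧
    (∀ i j k : Fin 5, i ≠ j → i ≠ k → j ≠ k → bracket M i j k ≠ 0) ∧
    ∀ σ : Equiv.Perm (Fin 5), (lineCrossRatio M (σ 0) (σ 1) (σ 2) (σ 3) (σ 4)).im ≠ 0

/-! ### The rolled coamoeba map and its critical locus -/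

/-- `V ∩ (ℂˣ)⁴`. -/
def torusPart (V : AffineSubspace ℂ (Fin 4 → ℂ)) : Set (Fin 4 → ℂ) :=
  {z | z ∈ V ∧ ∀ j, z j ≠ 0}

/-- The rolled coamoeba map: each coordinate `z j` is sent to the real line through the origin of
`ℂ` spanned by it, i.e. to `[Re (z j) : Im (z j)]` in the real projectivisation of `ℂ`. -/
def rolledCoamoeba (V : AffineSubspace ℂ (Fin 4 → ℂ)) (z : torusPart V) : Fin 4 → ℙ ℝ ℂ :=
  fun j => Projectivization.mk ℝ (z.1 j) (z.2.2 j)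

/-- The affine coordinate on the real projective line `ℙ ℝ ℂ`, centred at the line spanned by `w`:
it is defined on the lines `[z]` that are not perpendicular to `w`, and it is the tangent of the
angle from `w` to `z`. -/
def affineSlope (w z : ℂ) : ℝ := (z / w).im / (z / w).re

/-- The number `affineSlope w z` depends only on the real line `[z]` and determines it. -/
theorem affineSlope_eq_iff {w z z' : ℂ} (hz : z ≠ 0) (hz' : z' ≠ 0)
    (h : (z / w).re ≠ 0) (h' : (z' / w).re ≠ 0) :
    affineSlope w z = affineSlope w z' ↔ Projectivization.mk ℝ z hz = Projectivization.mk ℝ z' hz' := by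
  have hw : w ≠ 0 := by
    rintro rfl
    simp at h
  rw [Projectivization.mk_eq_mk_iff', affineSlope, affineSlope, div_eq_div_iff h h']
  constructor
  · intro e
    refine ⟨(z / w).re / (z' / w).re, ?_⟩
    have key : (((z / w).re / (z' / w).re : ℝ) : ℂ) * (z' / w) = z / w := by
      apply Complex.ext
      · rw [Complex.re_ofReal_mul]
        field_simp
      · rw [Complex.im_ofReal_mul]
        field_simp
        linarith
    rw [Complex.real_smul]
    calc _ = (((z / w).re / (z' / w).re : ℝ) : ℂ) * (z' / w) * w := by field_simp
      _ = z := by rw [key]; field_simp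
  · rintro ⟨a, rfl⟩
    rw [Complex.real_smul, mul_div_assoc, Complex.re_ofReal_mul, Complex.im_ofReal_mul]
    ring

/-- The local expression of the rolled coamoeba map near `z`, with the point `z + v` of `V` given
by `v ∈ V.direction` and with the affine coordinates on the four projective lines centred at the
image of `z`. -/
def localRolledCoamoeba (V : AffineSubspace ℂ (Fin 4 → ℂ)) (z : torusPart V) :
    V.direction → (Fin 4 → ℝ) :=
  fun v j => affineSlope (z.1 j) (z.1 j + v.1 j)

/-- The locus of critical points of the rolled coamoeba map: the points at which its (real)
differential is not surjective. -/
def criticalLocus (V : AffineSubspace ℂ (Fin 4 → ℂ)) : Set (torusPart V) :=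
  {z | ¬ Function.Surjective (fderiv ℝ (localRolledCoamoeba V z) 0)}

/-- The set of critical values of the rolled coamoeba map. -/
def criticalValues (V : AffineSubspace ℂ (Fin 4 → ℂ)) : Set (Fin 4 → ℙ ℝ ℂ) :=
  rolledCoamoeba V '' criticalLocus V

/-! ### The embedding in projective space -/

/-- The point `[z 0 : z 1 : z 2 : z 3 : 1]` of `ℂP⁴`. -/
def toProj (z : Fin 4 → ℂ) : ℙ ℂ (Fin 5 → ℂ) :=
  Projectivization.mk ℂ (Fin.snoc (α := fun _ => ℂ) z 1) fun h => by
    have h1 := congrFun h (Fin.last 4)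
    rw [Fin.snoc_last] at h1
    exact one_ne_zero h1

/-- The hyperplane of `ℂP⁴` where the `j`-th homogeneous coordinate vanishes; the last one is the
hyperplane at infinity. -/
def coordHyperplane (j : Fin 5) : Set (ℙ ℂ (Fin 5 → ℂ)) :=
  {p | ∀ v ∈ p.submodule, v j = 0}

end

/-! Let ℓ_0, …, ℓ_4 be the linear forms on ℂ³ that cut out the five lines, ℓ_4 = w being the one at
infinity. Adjoin the real axis to θ as a fifth direction, and let W_θ = `realLocus M θ` be the real
vector space of all u with ℓ_r(u) ∈ θ_r for every r. A point of V^×, normalised by w = 1, is mapped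
to θ exactly when its vector lies in W_θ, and the kernel of the differential there is W_θ ∩ {w = 0}.
Source and target have the same real dimension 4, so the point is critical iff dim W_θ ≥ 2
(`IsGenericMatrix.mem_criticalLocus_iff`).

Genericity bounds W_θ from above. Two independent vectors of W_θ in ker ℓ_m would make the four
intersection points on L_m lie on a circle, so their cross-ratio would be real
(`IsGenericMatrix.not_linearIndependent`). Up to a constant, ℓ_m is a real functional on W_θ, and
its kernel has dimension at most 1; hence dim W_θ ≤ 2. Over a critical value the real projective
line of W_θ is therefore a circle on which each ℓ_r has exactly one zero, and the fibre of Z is this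
circle without these zeros.

The compactification (`PencilSpace`) consists of all pairs of a critical value θ and a point of the
projective line of W_θ. It is compact because the set of critical values is closed
(`IsGenericMatrix.isClosed_hasRealPencil`). The sections are the zeros of the ℓ_r, and u ↦ [ℓ_0(u) :
… : ℓ_4(u)] gives the map to ℂP⁴. The five lines have no common point, so over each θ two sections
differ; the two corresponding forms are coordinates on the nearby W_θ and trivialise the bundle
(`IsGenericMatrix.exists_trivialization`). -/

noncomputable section

/-! ### Topology of projective spaces -/

section ProjectiveTopology

variable {𝕜 E : Type*} [NontriviallyNormedField 𝕜] [NormedAddCommGroup E] [NormedSpace 𝕜 E]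

theorem Projectivization.isOpenQuotientMap_mk' :
    IsOpenQuotientMap (Projectivization.mk' 𝕜 : {v : E // v ≠ 0} → ℙ 𝕜 E) := by
  refine ⟨fun p => ⟨⟨p.rep, p.rep_nonzero⟩, p.mk_rep⟩, continuous_coinduced_rng, fun U hU => ?_⟩
  rw [isOpen_coinduced]
  have key : Projectivization.mk' 𝕜 ⁻¹' (Projectivization.mk' 𝕜 '' U) =
      ⋃ a : 𝕜ˣ, (fun v : {v : E // v ≠ 0} => (⟨a • v.1, by
        simpa [Units.smul_def] using v.2⟩ : {v : E // v ≠ 0})) ⁻¹' U := by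
    ext v
    simp only [Set.mem_preimage, Set.mem_image, Set.mem_iUnion, Projectivization.mk'_eq_mk,
      Projectivization.mk_eq_mk_iff]
    constructor
    · rintro ⟨w, hw, a, ha⟩
      exact ⟨a, by simpa [ha] using hw⟩
    · rintro ⟨a, ha⟩
      exact ⟨_, ha, a, rfl⟩
  rw [key]
  refine isOpen_iUnion fun a => hU.preimage ?_
  exact (continuous_subtype_val.const_smul a).subtype_mk _

theorem Projectivization.continuous_mk' :
    Continuous (Projectivization.mk' 𝕜 : {v : E // v ≠ 0} → ℙ 𝕜 E) :=
  continuous_coinduced_rng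

/-- Two vectors span different lines iff they are linearly independent, which is an open condition.
-/
instance Projectivization.t2Space [CompleteSpace 𝕜] : T2Space (ℙ 𝕜 E) := by
  rw [t2Space_iff_of_isOpenQuotientMap Projectivization.isOpenQuotientMap_mk']
  have h : IsOpen {q : {v : E // v ≠ 0} × {v : E // v ≠ 0} |
      LinearIndependent 𝕜 ![q.1.1, q.2.1]} := by
    refine (isOpen_setOfPred_linearIndependent (𝕜 := 𝕜) (E := E) (ι := Fin 2)).preimage
      (f := fun q : {v : E // v ≠ 0} × {v : E // v ≠ 0} => ![q.1.1, q.2.1]) ?_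
    refine continuous_pi fun i => ?_
    fin_cases i
    · exact continuous_subtype_val.comp continuous_fst
    · exact continuous_subtype_val.comp continuous_snd
  convert! h.isClosed_compl using 1
  ext ⟨u, v⟩
  simp only [Set.mem_ofPred_eq, Set.mem_compl_iff, Projectivization.mk'_eq_mk]
  rw [eq_comm, Projectivization.mk_eq_mk_iff', LinearIndependent.pair_iff' u.2]
  push Not
  rfl

instance Projectivization.compactSpace [ProperSpace E] [NormedSpace ℝ E] [Algebra ℝ 𝕜]
    [IsScalarTower ℝ 𝕜 E] : CompactSpace (ℙ 𝕜 E) := by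
  have hK : IsCompact (Metric.sphere (0 : E) 1) := isCompact_sphere 0 1
  have : CompactSpace (Metric.sphere (0 : E) 1) := isCompact_iff_compactSpace.1 hK
  let g : Metric.sphere (0 : E) 1 → ℙ 𝕜 E := fun v =>
    Projectivization.mk' 𝕜 ⟨v.1, ne_zero_of_mem_unit_sphere v⟩
  have hg : Continuous g := Projectivization.continuous_mk'.comp
    (continuous_subtype_val.subtype_mk _)
  have hs : Function.Surjective g := fun p => by
    induction p using Projectivization.ind with
    | h v hv =>
      have hv' : ‖v‖ ≠ 0 := norm_ne_zero_iff.2 hv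
      refine ⟨⟨(‖v‖⁻¹ : ℝ) • v, by simp [norm_smul, hv']⟩, ?_⟩
      refine (Projectivization.mk_eq_mk_iff' _ _ _ _ _).2 ⟨algebraMap ℝ 𝕜 ‖v‖⁻¹, ?_⟩
      rw [algebraMap_smul]
  exact hs.compactSpace hg

/-- Continuity on an open set of the projective space can be tested on nonzero vectors. -/
theorem Projectivization.continuousOn_iff {Y : Type*} [TopologicalSpace Y] {g : ℙ 𝕜 E → Y}
    {s : Set (ℙ 𝕜 E)} (hs : IsOpen s) :
    ContinuousOn g s ↔
      ContinuousOn (g ∘ Projectivization.mk' 𝕜) (Projectivization.mk' 𝕜 ⁻¹' s) :=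
  Projectivization.isOpenQuotientMap_mk'.isQuotientMap.continuousOn_isOpen_iff hs

end ProjectiveTopology

/-! ### Real lines in ℂ -/

theorem mem_span_singleton_iff_im {z w : ℂ} (hz : z ≠ 0) :
    w ∈ Submodule.span ℝ {z} ↔ (w / z).im = 0 := by
  rw [Submodule.mem_span_singleton]
  constructor
  · rintro ⟨a, rfl⟩
    rw [Complex.real_smul, mul_div_assoc, div_self hz]
    simp
  · intro h
    refine ⟨(w / z).re, ?_⟩
    have : (((w / z).re : ℝ) : ℂ) = w / z := Complex.ext (by simp) (by simp [h])
    rw [Complex.real_smul, this, div_mul_cancel₀ _ hz]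

theorem isClosed_mem_submodule : IsClosed {q : ℙ ℝ ℂ × ℂ | q.2 ∈ q.1.submodule} := by
  have h := (Projectivization.isOpenQuotientMap_mk' (𝕜 := ℝ) (E := ℂ)).prodMap
    (IsOpenQuotientMap.id (X := ℂ))
  rw [← h.isQuotientMap.isClosed_preimage]
  have : IsClosed {q : {v : ℂ // v ≠ 0} × ℂ | (q.2 / q.1.1).im = 0} := by
    refine isClosed_eq (Complex.continuous_im.comp (continuous_snd.div
      (continuous_subtype_val.comp continuous_fst) fun q => q.1.2)) continuous_const
  convert! this using 1
  ext q
  simp only [Set.mem_preimage, Set.mem_ofPred_eq, Prod.map, Projectivization.mk'_eq_mk,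
    Projectivization.submodule_mk, id]
  exact mem_span_singleton_iff_im q.1.2

theorem isOpen_rep_re_ne_zero (a : ℂ) : IsOpen {q : ℙ ℝ ℂ | (q.rep / a).re ≠ 0} := by
  rw [← (Projectivization.isOpenQuotientMap_mk' (𝕜 := ℝ) (E := ℂ)).isQuotientMap.isOpen_preimage]
  have : IsOpen {q : {v : ℂ // v ≠ 0} | (q.1 / a).re ≠ 0} :=
    isOpen_ne_fun (Complex.continuous_re.comp (continuous_subtype_val.div_const a))
      continuous_const
  convert! this using 1
  ext q
  obtain ⟨t, ht⟩ := Projectivization.exists_smul_eq_mk_rep ℝ q.1 q.2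
  simp only [Set.mem_preimage, Set.mem_ofPred_eq, Projectivization.mk'_eq_mk, ← ht,
    Units.smul_def, Complex.real_smul, mul_div_assoc, Complex.re_ofReal_mul]
  simp

/-! ### The five functionals and their real loci -/

/-- The condition on the parameters of a plane in `IsGenericPlane`. -/
def IsGenericMatrix (M : Matrix (Fin 4) (Fin 3) ℂ) : Prop :=
  (∀ i j k : Fin 5, i ≠ j → i ≠ k → j ≠ k → bracket M i j k ≠ 0) ∧
    ∀ σ : Equiv.Perm (Fin 5), (lineCrossRatio M (σ 0) (σ 1) (σ 2) (σ 3) (σ 4)).im ≠ 0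

/-- The linear functional on `ℂ³` with coefficients `lineForm M r`. -/
def lineFunctional (M : Matrix (Fin 4) (Fin 3) ℂ) (r : Fin 5) : (Fin 3 → ℂ) →ₗ[ℂ] ℂ where
  toFun u := lineForm M r ⬝ᵥ u
  map_add' u v := dotProduct_add _ u v
  map_smul' c u := dotProduct_smul c _ u

theorem lineFunctional_apply (M : Matrix (Fin 4) (Fin 3) ℂ) (r : Fin 5) (u : Fin 3 → ℂ) :
    lineFunctional M r u = lineForm M r ⬝ᵥ u := rfl

theorem lineFunctional_real_smul (M : Matrix (Fin 4) (Fin 3) ℂ) (r : Fin 5) (t : ℝ)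
    (u : Fin 3 → ℂ) : lineFunctional M r (t • u) = t * lineFunctional M r u := by
  rw [LinearMap.map_smul_of_tower, Complex.real_smul]

theorem lineFunctional_castSucc (M : Matrix (Fin 4) (Fin 3) ℂ) (j : Fin 4) (u : Fin 3 → ℂ) :
    lineFunctional M j.castSucc u = M j 0 * u 0 + M j 1 * u 1 + M j 2 * u 2 := by
  have h : lineForm M j.castSucc = M j := Fin.snoc_castSucc (α := fun _ => Fin 3 → ℂ) _ _ j
  rw [lineFunctional_apply, h, dotProduct, Fin.sum_univ_three]

theorem lineFunctional_last (M : Matrix (Fin 4) (Fin 3) ℂ) (u : Fin 3 → ℂ) :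
    lineFunctional M (Fin.last 4) u = u 2 := by
  have h : lineForm M (Fin.last 4) = ![0, 0, 1] := Fin.snoc_last (α := fun _ => Fin 3 → ℂ) _ _
  rw [lineFunctional_apply, h, dotProduct, Fin.sum_univ_three]
  simp

theorem continuous_lineFunctional (M : Matrix (Fin 4) (Fin 3) ℂ) (r : Fin 5) :
    Continuous (lineFunctional M r) :=
  (lineFunctional M r).continuous_of_finiteDimensional

theorem eq_zero_of_lineFunctional_eq_zero {M : Matrix (Fin 4) (Fin 3) ℂ} {i j k : Fin 5}
    (h : bracket M i j k ≠ 0) {u : Fin 3 → ℂ} (hi : lineFunctional M i u = 0)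
    (hj : lineFunctional M j u = 0) (hk : lineFunctional M k u = 0) : u = 0 := by
  refine Matrix.eq_zero_of_mulVec_eq_zero h ?_
  ext r
  fin_cases r
  exacts [hi, hj, hk]

theorem exists_lineFunctional_eq {M : Matrix (Fin 4) (Fin 3) ℂ} {i j k : Fin 5}
    (h : bracket M i j k ≠ 0) (w : Fin 3 → ℂ) : ∃ u, lineFunctional M i u = w 0 ∧
      lineFunctional M j u = w 1 ∧ lineFunctional M k u = w 2 := by
  refine ⟨(Matrix.of ![lineForm M i, lineForm M j, lineForm M k])⁻¹.mulVec w, ?_⟩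
  have key := Matrix.mulVec_mulVec w (Matrix.of ![lineForm M i, lineForm M j, lineForm M k])
    (Matrix.of ![lineForm M i, lineForm M j, lineForm M k])⁻¹
  rw [Matrix.mul_nonsing_inv _ (isUnit_iff_ne_zero.2 h), Matrix.one_mulVec] at key
  exact ⟨congrFun key 0, congrFun key 1, congrFun key 2⟩

/-- Multiply the matrix of the three forms by the one with columns g, u, v: the first row of the
product is (ℓ_m(g), 0, 0). This turns brackets containing m into 2 × 2 minors on ker ℓ_m, up to a
factor independent of i and k. -/
theorem bracket_mul_det (M : Matrix (Fin 4) (Fin 3) ℂ) (m i k : Fin 5) {g u v : Fin 3 → ℂ}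
    (hu : lineFunctional M m u = 0) (hv : lineFunctional M m v = 0) :
    bracket M m i k * Matrix.det (Matrix.of ![g, u, v]) = lineFunctional M m g *
      (lineFunctional M i u * lineFunctional M k v -
        lineFunctional M k u * lineFunctional M i v) := by
  have key : Matrix.of ![lineForm M m, lineForm M i, lineForm M k] *
      (Matrix.of ![g, u, v]).transpose =
      !![lineFunctional M m g, lineFunctional M m u, lineFunctional M m v;
         lineFunctional M i g, lineFunctional M i u, lineFunctional M i v;
         lineFunctional M k g, lineFunctional M k u, lineFunctional M k v] := by
    ext a b
    fin_cases a <;> fin_cases b <;> rfl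
  rw [bracket, ← Matrix.det_transpose (Matrix.of ![g, u, v]), ← Matrix.det_mul, key,
    Matrix.det_fin_three]
  simp only [hu, hv, Matrix.of_apply, Matrix.cons_val', Matrix.cons_val_zero, Matrix.cons_val_one,
    Matrix.cons_val_fin_one, Matrix.cons_val]
  ring

/-- The four real lines `θ j` in `ℂ`, together with the real axis. -/
def withRealAxis (θ : Fin 4 → ℙ ℝ ℂ) : Fin 5 → ℙ ℝ ℂ :=
  Fin.snoc (α := fun _ => ℙ ℝ ℂ) θ (Projectivization.mk ℝ 1 one_ne_zero)

theorem continuous_withRealAxis (r : Fin 5) : Continuous fun θ => withRealAxis θ r := by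
  unfold withRealAxis
  induction r using Fin.lastCases with
  | last => simpa only [Fin.snoc_last] using continuous_const
  | cast j => simpa only [Fin.snoc_castSucc] using continuous_apply j

/-- The vectors of `ℂ³` at which the values of the five functionals lie in given real lines. -/
def realLocus (M : Matrix (Fin 4) (Fin 3) ℂ) (θ : Fin 4 → ℙ ℝ ℂ) : Submodule ℝ (Fin 3 → ℂ) :=
  ⨅ r, (withRealAxis θ r).submodule.comap ((lineFunctional M r).restrictScalars ℝ)

variable {M : Matrix (Fin 4) (Fin 3) ℂ} {θ : Fin 4 → ℙ ℝ ℂ}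

theorem mem_realLocus {u : Fin 3 → ℂ} :
    u ∈ realLocus M θ ↔ ∀ r, lineFunctional M r u ∈ (withRealAxis θ r).submodule := by
  simp [realLocus]

theorem mem_realLocus_iff {u : Fin 3 → ℂ} :
    u ∈ realLocus M θ ↔ (∀ j, lineFunctional M (Fin.castSucc j) u ∈ (θ j).submodule) ∧
      (lineFunctional M (Fin.last 4) u).im = 0 := by
  rw [mem_realLocus, Fin.forall_fin_succ', withRealAxis]
  simp only [Fin.snoc_castSucc, Fin.snoc_last, Projectivization.submodule_mk]
  rw [mem_span_singleton_iff_im one_ne_zero, div_one]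

theorem exists_real_of_mem_realLocus {u : Fin 3 → ℂ} (hu : u ∈ realLocus M θ) (r : Fin 5) :
    ∃ x : ℝ, lineFunctional M r u = x * (withRealAxis θ r).rep := by
  have h := mem_realLocus.1 hu r
  rw [Projectivization.submodule_eq, Submodule.mem_span_singleton] at h
  obtain ⟨x, hx⟩ := h
  exact ⟨x, by rw [← hx, Complex.real_smul]⟩

/-- The real locus meets each of the five complex planes in at most a real line, because the
cross-ratio on the corresponding projective line is not real. -/
theorem IsGenericMatrix.not_linearIndependent (h : IsGenericMatrix M) (m : Fin 5)
    {u v : Fin 3 → ℂ} (hu : u ∈ realLocus M θ) (hv : v ∈ realLocus M θ)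
    (hmu : lineFunctional M m u = 0) (hmv : lineFunctional M m v = 0) :
    ¬ LinearIndependent ℝ ![u, v] := by
  intro hl
  rw [LinearIndependent.pair_iff] at hl
  choose x hx using exists_real_of_mem_realLocus hu
  choose y hy using exists_real_of_mem_realLocus hv
  -- With ℓ_r(u) = x_r ρ_r and ℓ_r(v) = y_r ρ_r, where x_r, y_r are real and ρ_r spans the r-th
  -- direction, the vector y_k u − x_k v is killed by ℓ_k, and also by ℓ_i if the real minor of i, k
  -- vanishes.
  have comb (i k : Fin 5) (hd : x i * y k - x k * y i = 0) :
      lineFunctional M i (y k • u + (-x k) • v) = 0 := by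
    rw [map_add, lineFunctional_real_smul, lineFunctional_real_smul, hx, hy]
    have : ((x i * y k - x k * y i : ℝ) : ℂ) = 0 := by rw [hd]; simp
    push_cast at this ⊢
    linear_combination (withRealAxis θ i).rep * this
  have comb_m (k : Fin 5) : lineFunctional M m (y k • u + (-x k) • v) = 0 := by
    rw [map_add, lineFunctional_real_smul, lineFunctional_real_smul, hmu, hmv]
    simp
  have minor (i k : Fin 5) (hmi : m ≠ i) (hmk : m ≠ k) (hik : i ≠ k) :
      x i * y k - x k * y i ≠ 0 := by
    intro hd
    have hb := h.1 m i k hmi hmk hik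
    have h1 := hl _ _ (eq_zero_of_lineFunctional_eq_zero hb (comb_m k) (comb i k hd)
      (comb k k (sub_self _)))
    have h2 := hl _ _ (eq_zero_of_lineFunctional_eq_zero hb (comb_m i) (comb i i (sub_self _))
      (comb k i (by linarith)))
    have hu0 : u = 0 := eq_zero_of_lineFunctional_eq_zero hb hmu
      (by rw [hx, neg_eq_zero.1 h2.2]; simp) (by rw [hx, neg_eq_zero.1 h1.2]; simp)
    exact one_ne_zero (hl 1 0 (by simp [hu0])).1
  let σ : Equiv.Perm (Fin 5) := Equiv.swap 0 m
  have hσ : σ 0 = m := Equiv.swap_apply_left 0 m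
  have hne (a b : Fin 5) (hab : a ≠ b) : σ a ≠ σ b := σ.injective.ne hab
  -- g completes u, v to a basis of ℂ³, so that every bracket of m, i, k is a real minor times ρ_i
  -- ρ_k, divided by the common factor det(g, u, v).
  obtain ⟨g, hg, -, -⟩ := exists_lineFunctional_eq
    (h.1 m (σ 1) (σ 2) (hσ ▸ hne 0 1 (by decide)) (hσ ▸ hne 0 2 (by decide))
      (hne 1 2 (by decide))) ![1, 0, 0]
  have hg1 : lineFunctional M m g = 1 := hg
  have hr (r : Fin 5) : (withRealAxis θ r).rep ≠ 0 := (withRealAxis θ r).rep_nonzero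
  have hD (i k : Fin 5) : bracket M m i k * Matrix.det (Matrix.of ![g, u, v]) =
      ((x i * y k - x k * y i : ℝ) : ℂ) * ((withRealAxis θ i).rep * (withRealAxis θ k).rep) := by
    rw [bracket_mul_det M m i k hmu hmv, hg1, hx, hx, hy, hy]
    push_cast
    ring
  have minor' (a b : Fin 5) (ha : 0 ≠ a) (hb : 0 ≠ b) (hab : a ≠ b) :=
    minor (σ a) (σ b) (hσ ▸ hne 0 a ha) (hσ ▸ hne 0 b hb) (hne a b hab)
  have hD0 : Matrix.det (Matrix.of ![g, u, v]) ≠ 0 := by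
    intro h0
    have := hD (σ 1) (σ 2)
    rw [h0, mul_zero] at this
    exact mul_ne_zero (Complex.ofReal_ne_zero.2 (minor' 1 2 (by decide) (by decide) (by decide)))
      (mul_ne_zero (hr _) (hr _)) this.symm
  refine h.2 σ ?_
  have hb (i k : Fin 5) : bracket M m i k = ((x i * y k - x k * y i : ℝ) : ℂ) *
      ((withRealAxis θ i).rep * (withRealAxis θ k).rep) /
        Matrix.det (Matrix.of ![g, u, v]) := by
    rw [← hD, mul_div_cancel_right₀ _ hD0]
  -- Each of the four ρ's occurs once in the numerator and once in the denominator; they cancel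
  -- together with the determinants and leave a quotient of real minors.
  have key : lineCrossRatio M (σ 0) (σ 1) (σ 2) (σ 3) (σ 4) =
      (((x (σ 1) * y (σ 3) - x (σ 3) * y (σ 1)) * (x (σ 2) * y (σ 4) - x (σ 4) * y (σ 2)) /
        ((x (σ 1) * y (σ 4) - x (σ 4) * y (σ 1)) * (x (σ 2) * y (σ 3) - x (σ 3) * y (σ 2))) :
          ℝ) : ℂ) := by
    have h14 := Complex.ofReal_ne_zero.2 (minor' 1 4 (by decide) (by decide) (by decide))
    have h23 := Complex.ofReal_ne_zero.2 (minor' 2 3 (by decide) (by decide) (by decide))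
    have h1 := hr (σ 1)
    have h2 := hr (σ 2)
    have h3 := hr (σ 3)
    have h4 := hr (σ 4)
    rw [lineCrossRatio, hσ, hb, hb, hb, hb, Complex.ofReal_div, Complex.ofReal_mul,
      Complex.ofReal_mul]
    field_simp
  rw [key, Complex.ofReal_im]

theorem IsGenericMatrix.mk_eq_mk (h : IsGenericMatrix M) (m : Fin 5)
    {u v : Fin 3 → ℂ} (hu : u ∈ realLocus M θ) (hv : v ∈ realLocus M θ)
    (hmu : lineFunctional M m u = 0) (hmv : lineFunctional M m v = 0) (hu0 : u ≠ 0)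
    (hv0 : v ≠ 0) : Projectivization.mk ℝ u hu0 = Projectivization.mk ℝ v hv0 := by
  have := h.not_linearIndependent m hv hu hmv hmu
  rw [LinearIndependent.pair_iff' hv0] at this
  push Not at this
  exact (Projectivization.mk_eq_mk_iff' _ _ _ _ _).2 this

/-- The real locus has real dimension at least two. -/
def HasRealPencil (M : Matrix (Fin 4) (Fin 3) ℂ) (θ : Fin 4 → ℙ ℝ ℂ) : Prop :=
  ∃ u ∈ realLocus M θ, ∃ v ∈ realLocus M θ, LinearIndependent ℝ ![u, v]

/-- On the real locus ℓ_r takes values in one real line, so it is a real functional there and has a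
kernel in dimension at least two. -/
theorem HasRealPencil.exists_eq_zero (h : HasRealPencil M θ) (r : Fin 5) :
    ∃ v ∈ realLocus M θ, v ≠ 0 ∧ lineFunctional M r v = 0 := by
  obtain ⟨u, hu, v, hv, hl⟩ := h
  obtain ⟨x, hx⟩ := exists_real_of_mem_realLocus hu r
  obtain ⟨y, hy⟩ := exists_real_of_mem_realLocus hv r
  rw [LinearIndependent.pair_iff] at hl
  by_cases h0 : x = 0
  · refine ⟨u, hu, fun h => one_ne_zero (hl 1 0 (by simp [h])).1, by simp [hx, h0]⟩
  · refine ⟨y • u + (-x) • v, Submodule.add_mem _ (Submodule.smul_mem _ _ hu)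
      (Submodule.smul_mem _ _ hv), fun h => h0 (neg_eq_zero.1 (hl _ _ h).2), ?_⟩
    rw [map_add, lineFunctional_real_smul, lineFunctional_real_smul, hx, hy]
    push_cast
    ring

/-- This form of the condition involves only single vectors, so its closedness follows by projecting
from a compact space. For the converse: in dimension at most one all the v_r are proportional, and
one vector would lie on all five lines. -/
theorem IsGenericMatrix.hasRealPencil_iff (hM : IsGenericMatrix M) : HasRealPencil M θ ↔
    ∀ r, ∃ v ∈ realLocus M θ, v ≠ 0 ∧ lineFunctional M r v = 0 := by
  refine ⟨fun h => h.exists_eq_zero, fun h => ?_⟩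
  choose v hv hv0 hr using h
  by_contra hP
  have hz (r : Fin 5) : lineFunctional M r (v 0) = 0 := by
    have : ¬ LinearIndependent ℝ ![v r, v 0] := fun hl => hP ⟨_, hv r, _, hv 0, hl⟩
    rw [LinearIndependent.pair_iff' (hv0 r)] at this
    push Not at this
    obtain ⟨a, ha⟩ := this
    rw [← ha, lineFunctional_real_smul, hr, mul_zero]
  exact hv0 0 (eq_zero_of_lineFunctional_eq_zero (hM.1 0 1 2 (by decide) (by decide) (by decide))
    (hz 0) (hz 1) (hz 2))

theorem finite_setOf_add_smul_eq_zero {a b : ℂ} (h : ¬ (a = 0 ∧ b = 0)) :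
    {t : ℝ | a + t * b = 0}.Finite := by
  refine Set.Subsingleton.finite fun s hs t ht => ?_
  have hs' : a + s * b = 0 := hs
  have ht' : a + t * b = 0 := ht
  by_cases hb : b = 0
  · exact (h ⟨by simpa [hb] using hs', hb⟩).elim
  · have : ((s : ℂ) - t) * b = 0 := by linear_combination hs' - ht'
    have := (mul_eq_zero.1 this).resolve_right hb
    exact_mod_cast sub_eq_zero.1 this

/-- On the line u + t v each functional vanishes for at most one t, since u and v are not both in
its kernel. -/
theorem IsGenericMatrix.exists_forall_ne_zero (hM : IsGenericMatrix M) (h : HasRealPencil M θ) :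
    ∃ v ∈ realLocus M θ, ∀ r, lineFunctional M r v ≠ 0 := by
  obtain ⟨u, hu, v, hv, hl⟩ := h
  have hfin : (⋃ r, {t : ℝ | lineFunctional M r u + t * lineFunctional M r v = 0}).Finite :=
    Set.finite_iUnion fun r => finite_setOf_add_smul_eq_zero fun h0 =>
      hM.not_linearIndependent r hu hv h0.1 h0.2 hl
  obtain ⟨t, ht⟩ := hfin.infinite_compl.nonempty
  refine ⟨u + t • v, Submodule.add_mem _ hu (Submodule.smul_mem _ _ hv), fun r hr => ht ?_⟩
  rw [map_add, lineFunctional_real_smul] at hr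
  exact Set.mem_iUnion.2 ⟨r, hr⟩

/-- The upper bound dim ≤ 2: subtracting a real multiple of w from u leads into ker ℓ_i, where the
real locus is at most a line. -/
theorem IsGenericMatrix.exists_eq_add (hM : IsGenericMatrix M) {i : Fin 5} {v w u : Fin 3 → ℂ}
    (hv : v ∈ realLocus M θ) (hw : w ∈ realLocus M θ) (hu : u ∈ realLocus M θ) (hv0 : v ≠ 0)
    (hvi : lineFunctional M i v = 0) (hwi : lineFunctional M i w ≠ 0) :
    ∃ x y : ℝ, u = x • v + y • w := by
  obtain ⟨a, ha⟩ := exists_real_of_mem_realLocus hu i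
  obtain ⟨b, hb⟩ := exists_real_of_mem_realLocus hw i
  have hb0 : b ≠ 0 := by
    rintro rfl
    simp [hb] at hwi
  have hz : lineFunctional M i (u - (a / b) • w) = 0 := by
    have hb0' : (b : ℂ) ≠ 0 := Complex.ofReal_ne_zero.2 hb0
    rw [map_sub, lineFunctional_real_smul, ha, hb]
    push_cast
    field_simp
    ring
  have := hM.not_linearIndependent i hv
    (Submodule.sub_mem _ hu (Submodule.smul_mem _ (a / b) hw)) hvi hz
  rw [LinearIndependent.pair_iff' hv0] at this
  push Not at this
  obtain ⟨x, hx⟩ := this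
  exact ⟨x, a / b, by rw [hx]; abel⟩

/-- The line through two intersection points `L k ∩ L l` and `L i ∩ L m` of the five lines meets
them in three points only, so that these lie on a circle. -/
theorem IsGenericMatrix.exists_hasRealPencil (hM : IsGenericMatrix M) {i j : Fin 5} (hij : i ≠ j) :
    ∃ θ, HasRealPencil M θ ∧
      ∃ v ∈ realLocus M θ, lineFunctional M i v = 0 ∧ lineFunctional M j v ≠ 0 := by
  have hidx : ∀ i j : Fin 5, i ≠ j → ∃ k l m : Fin 5, k ≠ i ∧ k ≠ j ∧ l ≠ i ∧ l ≠ j ∧ m ≠ i ∧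
      m ≠ j ∧ k ≠ l ∧ k ≠ m ∧ l ≠ m ∧ ∀ r, r = i ∨ r = j ∨ r = k ∨ r = l ∨ r = m := by decide
  obtain ⟨k, l, m, hki, hkj, hli, hlj, hmi, hmj, hkl, hkm, hlm, hr⟩ := hidx i j hij
  -- a spans L_k ∩ L_l and b spans L_i ∩ L_m, both scaled so that ℓ_j takes the value 1.
  obtain ⟨a, hak, hal, haj⟩ := exists_lineFunctional_eq (hM.1 k l j hkl hkj hlj) ![0, 0, 1]
  obtain ⟨b, hbi, hbm, hbj⟩ := exists_lineFunctional_eq (hM.1 i m j hmi.symm hij hmj) ![0, 0, 1]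
  simp only [Matrix.cons_val_zero, Matrix.cons_val_one, Matrix.cons_val] at hak hal haj hbi hbm hbj
  have ha0 : a ≠ 0 := by
    rintro rfl
    simp at haj
  have hb0 : b ≠ 0 := by
    rintro rfl
    simp at hbj
  have hai : lineFunctional M i a ≠ 0 := fun h0 =>
    ha0 (eq_zero_of_lineFunctional_eq_zero (hM.1 k l i hkl hki hli) hak hal h0)
  have ham : lineFunctional M m a ≠ 0 := fun h0 =>
    ha0 (eq_zero_of_lineFunctional_eq_zero (hM.1 k l m hkl hkm hlm) hak hal h0)
  have hbk : lineFunctional M k b ≠ 0 := fun h0 =>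
    hb0 (eq_zero_of_lineFunctional_eq_zero (hM.1 i m k hmi.symm hki.symm hkm.symm) hbi hbm h0)
  have hbl : lineFunctional M l b ≠ 0 := fun h0 =>
    hb0 (eq_zero_of_lineFunctional_eq_zero (hM.1 i m l hmi.symm hli.symm hlm.symm) hbi hbm h0)
  have hu (r : Fin 5) : lineFunctional M r (a + b) ≠ 0 := by
    rw [map_add]
    rcases hr r with rfl | rfl | rfl | rfl | rfl
    · simpa [hbi] using hai
    · rw [haj, hbj]; norm_num
    · simpa [hak] using hbk
    · simpa [hal] using hbl
    · simpa [hbm] using ham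
  -- All values of b relative to a + b are real (0, 1/2 or 1), so a + b and b span a real pencil in
  -- the directions of a + b.
  have hq (r : Fin 5) : ∃ x : ℝ, lineFunctional M r b = x * lineFunctional M r (a + b) := by
    rw [map_add]
    rcases hr r with rfl | rfl | rfl | rfl | rfl
    · exact ⟨0, by simp [hbi]⟩
    · exact ⟨1 / 2, by rw [haj, hbj]; norm_num⟩
    · exact ⟨1, by simp [hak]⟩
    · exact ⟨1, by simp [hal]⟩
    · exact ⟨0, by simp [hbm]⟩
  -- The fifth direction must be the real axis; dividing by the last coordinate of a + b achieves
  -- this.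
  set c : ℂ := lineFunctional M (Fin.last 4) (a + b) with hc
  have hc0 : c ≠ 0 := hu _
  let θ : Fin 4 → ℙ ℝ ℂ := fun j => Projectivization.mk ℝ
    (lineFunctional M j.castSucc (c⁻¹ • (a + b)))
    (by rw [map_smul]; exact smul_ne_zero (inv_ne_zero hc0) (hu _))
  have hmem : ∀ v : Fin 3 → ℂ, (∀ r, ∃ x : ℝ, lineFunctional M r v =
      x * lineFunctional M r (a + b)) → c⁻¹ • v ∈ realLocus M θ := by
    intro v hv
    rw [mem_realLocus_iff]
    constructor
    · intro j
      rw [Projectivization.submodule_mk, Submodule.mem_span_singleton]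
      obtain ⟨x, hx⟩ := hv j.castSucc
      refine ⟨x, ?_⟩
      rw [map_smul, map_smul, hx, Complex.real_smul, smul_eq_mul, smul_eq_mul]
      ring
    · obtain ⟨x, hx⟩ := hv (Fin.last 4)
      rw [map_smul, hx, ← hc, smul_eq_mul, mul_left_comm, inv_mul_cancel₀ hc0]
      simp
  have hb := hmem b hq
  have hab := hmem (a + b) fun r => ⟨1, by simp⟩
  have hbj' : lineFunctional M j (c⁻¹ • b) ≠ 0 := by
    rw [map_smul, hbj]
    simpa using hc0
  refine ⟨θ, ⟨_, hb, _, hab, ?_⟩, c⁻¹ • b, hb, by rw [map_smul, hbi, smul_zero], hbj'⟩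
  rw [LinearIndependent.pair_iff' (smul_ne_zero (inv_ne_zero hc0) hb0)]
  intro t ht
  have h1 := congrArg (lineFunctional M i) ht
  rw [lineFunctional_real_smul, map_smul, map_smul, map_add, hbi] at h1
  simp [hc0, hai] at h1

/-! ### Critical points and critical values of the rolled coamoeba map -/

section

variable {M : Matrix (Fin 4) (Fin 3) ℂ}

/-- The values of the four coordinates of `ℂ⁴` at a point given in homogeneous coordinates. -/
def planePoint (M : Matrix (Fin 4) (Fin 3) ℂ) (u : Fin 3 → ℂ) : Fin 4 → ℂ :=
  fun j => lineFunctional M j.castSucc u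

theorem mem_direction_affinePlane {v : Fin 4 → ℂ} :
    v ∈ (affinePlane M).direction ↔ ∃ u : Fin 3 → ℂ, u 2 = 0 ∧ planePoint M u = v := by
  rw [affinePlane, AffineSubspace.direction_mk', Submodule.mem_span_pair]
  constructor
  · rintro ⟨a, b, rfl⟩
    refine ⟨![a, b, 0], rfl, funext fun j => ?_⟩
    simp [planePoint, lineFunctional_castSucc, mul_comm]
  · rintro ⟨u, hu, rfl⟩
    refine ⟨u 0, u 1, funext fun j => ?_⟩
    simp [planePoint, lineFunctional_castSucc, hu, mul_comm]

theorem mem_affinePlane {z : Fin 4 → ℂ} :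
    z ∈ affinePlane M ↔ ∃ u : Fin 3 → ℂ, u 2 = 1 ∧ planePoint M u = z := by
  rw [affinePlane, AffineSubspace.mem_mk', vsub_eq_sub, Submodule.mem_span_pair]
  constructor
  · rintro ⟨a, b, h⟩
    refine ⟨![a, b, 1], rfl, funext fun j => ?_⟩
    have := congrFun h j
    simp only [Pi.add_apply, Pi.smul_apply, smul_eq_mul, Pi.sub_apply] at this
    simp only [planePoint, lineFunctional_castSucc, Matrix.cons_val_zero, Matrix.cons_val_one,
      Matrix.cons_val]
    linear_combination this
  · rintro ⟨u, hu, rfl⟩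
    refine ⟨u 0, u 1, funext fun j => ?_⟩
    simp only [planePoint, lineFunctional_castSucc, hu, Pi.add_apply, Pi.smul_apply, smul_eq_mul,
      Pi.sub_apply]
    ring

theorem IsGenericMatrix.planePoint_injective (hM : IsGenericMatrix M) :
    Function.Injective (planePoint M) := fun u v h => by
  have h' (j : Fin 4) : lineFunctional M j.castSucc (u - v) = 0 := by
    rw [map_sub, sub_eq_zero]
    exact congrFun h j
  exact sub_eq_zero.1 (eq_zero_of_lineFunctional_eq_zero
    (hM.1 (Fin.castSucc 0) (Fin.castSucc 1) (Fin.castSucc 2) (by decide) (by decide) (by decide))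
    (h' 0) (h' 1) (h' 2))

end

/-- At the base point the quotient (a + L v) / a is 1, with real part 1 and imaginary part 0, so
only the derivative of the imaginary part survives. -/
theorem hasFDerivAt_affineSlope (a : ℂ) {E : Type*} [NormedAddCommGroup E] [NormedSpace ℝ E]
    (L : E →L[ℝ] ℂ) (ha : a ≠ 0) :
    HasFDerivAt (fun v => affineSlope a (a + L v))
      (Complex.imCLM.comp (a⁻¹ • L)) 0 := by
  have h1 : HasFDerivAt (fun v => (a + L v) / a) (a⁻¹ • L) 0 := by
    have := (L.hasFDerivAt (x := 0)).const_add a |>.const_smul a⁻¹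
    refine this.congr_of_eventuallyEq (Filter.Eventually.of_forall fun v => ?_)
    simp [div_eq_inv_mul]
  have hg : HasFDerivAt (fun v => ((a + L v) / a).im) (Complex.imCLM.comp (a⁻¹ • L)) 0 :=
    Complex.imCLM.hasFDerivAt.comp (0 : E) h1
  have hh : HasFDerivAt (fun v => ((a + L v) / a).re) (Complex.reCLM.comp (a⁻¹ • L)) 0 :=
    Complex.reCLM.hasFDerivAt.comp (0 : E) h1
  have := hg.mul ((hasDerivAt_inv (by simp [ha])).comp_hasFDerivAt (0 : E) hh)
  refine (this.congr_fderiv ?_).congr_of_eventuallyEq (Filter.Eventually.of_forall fun v => ?_)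
  · simp [ha]
  · simp [affineSlope, div_eq_mul_inv]

theorem fderiv_localRolledCoamoeba (V : AffineSubspace ℂ (Fin 4 → ℂ)) (z : torusPart V)
    (v : V.direction) (j : Fin 4) :
    fderiv ℝ (localRolledCoamoeba V z) 0 v j = (v.1 j / z.1 j).im := by
  let L (j : Fin 4) : V.direction →L[ℝ] ℂ :=
    ((ContinuousLinearMap.proj j).comp V.direction.subtypeL).restrictScalars ℝ
  have h : HasFDerivAt (localRolledCoamoeba V z)
      (ContinuousLinearMap.pi fun j => Complex.imCLM.comp ((z.1 j)⁻¹ • L j)) 0 :=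
    hasFDerivAt_pi.2 fun j => hasFDerivAt_affineSlope (z.1 j) (L j) (z.2.2 j)
  rw [h.fderiv]
  simp [L, div_eq_inv_mul]

/-- Both sides of the differential have real dimension 4, so failing to be surjective means having a
kernel. -/
theorem mem_criticalLocus_iff_exists {V : AffineSubspace ℂ (Fin 4 → ℂ)}
    (hV : Module.finrank ℂ V.direction = 2) (z : torusPart V) :
    z ∈ criticalLocus V ↔ ∃ v ∈ V.direction, v ≠ 0 ∧ ∀ j, (v j / z.1 j).im = 0 := by
  have hdim : Module.finrank ℝ V.direction = Module.finrank ℝ (Fin 4 → ℝ) := by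
    rw [← Module.finrank_mul_finrank ℝ ℂ V.direction, hV]
    simp
  have : FiniteDimensional ℝ V.direction := FiniteDimensional.trans ℝ ℂ _
  have hiff := LinearMap.injective_iff_surjective_of_finrank_eq_finrank hdim
    (f := (fderiv ℝ (localRolledCoamoeba V z) 0).toLinearMap)
  rw [criticalLocus, Set.mem_ofPred_eq, ← ContinuousLinearMap.coe_coe, ← hiff,
    ← LinearMap.ker_eq_bot, Submodule.eq_bot_iff]
  push Not
  constructor
  · rintro ⟨v, hv, hv0⟩
    refine ⟨v.1, v.2, fun h => hv0 (Subtype.ext h), fun j => ?_⟩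
    rw [← fderiv_localRolledCoamoeba]
    exact congrFun hv j
  · rintro ⟨v, hv, hv0, h⟩
    refine ⟨⟨v, hv⟩, funext fun j => ?_, fun h => hv0 (congrArg Subtype.val h)⟩
    exact (fderiv_localRolledCoamoeba V z _ j).trans (h j)

section

variable {M : Matrix (Fin 4) (Fin 3) ℂ}

theorem mem_realLocus_rolledCoamoeba_iff (z : torusPart (affinePlane M)) {u : Fin 3 → ℂ} :
    u ∈ realLocus M (rolledCoamoeba _ z) ↔
      (∀ j, (planePoint M u j / z.1 j).im = 0) ∧ (u 2).im = 0 := by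
  rw [mem_realLocus_iff, lineFunctional_last]
  refine and_congr_left' (forall_congr' fun j => ?_)
  rw [rolledCoamoeba, Projectivization.submodule_mk, mem_span_singleton_iff_im (z.2.2 j)]
  rfl

theorem mem_realLocus_of_planePoint_eq (z : torusPart (affinePlane M)) {u : Fin 3 → ℂ}
    (hu : u 2 = 1) (h : planePoint M u = z.1) : u ∈ realLocus M (rolledCoamoeba _ z) := by
  rw [mem_realLocus_rolledCoamoeba_iff, h, hu]
  exact ⟨fun j => by rw [div_self (z.2.2 j), Complex.one_im], Complex.one_im⟩

/-- A kernel vector of the differential lies in the real locus and has w = 0; the point itself lies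
there with w = 1, so the two are independent. Conversely, a pencil contains a nonzero vector with w
= 0. -/
theorem IsGenericMatrix.mem_criticalLocus_iff (hM : IsGenericMatrix M)
    (hV : Module.finrank ℂ (affinePlane M).direction = 2) (z : torusPart (affinePlane M)) :
    z ∈ criticalLocus _ ↔ HasRealPencil M (rolledCoamoeba _ z) := by
  rw [mem_criticalLocus_iff_exists hV]
  constructor
  · rintro ⟨v, hv, hv0, h⟩
    obtain ⟨v, hv2, rfl⟩ := mem_direction_affinePlane.1 hv
    obtain ⟨u, hu2, huz⟩ := mem_affinePlane.1 z.2.1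
    have hu0 : u ≠ 0 := by
      rintro rfl
      simp at hu2
    refine ⟨u, mem_realLocus_of_planePoint_eq z hu2 huz, v,
      (mem_realLocus_rolledCoamoeba_iff z).2 ⟨h, by simp [hv2]⟩, ?_⟩
    rw [LinearIndependent.pair_iff' hu0]
    rintro a rfl
    have ha : a = 0 := by simpa [hu2] using hv2
    refine hv0 (funext fun j => ?_)
    simp [planePoint, ha]
  · intro h
    obtain ⟨v, hv, hv0, hv4⟩ := h.exists_eq_zero (Fin.last 4)
    rw [lineFunctional_last] at hv4
    refine ⟨planePoint M v, mem_direction_affinePlane.2 ⟨v, hv4, rfl⟩, fun h0 => hv0 ?_,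
      ((mem_realLocus_rolledCoamoeba_iff z).1 hv).1⟩
    exact hM.planePoint_injective (h0.trans (funext fun j => by simp [planePoint]))

/-- The last coordinate of v is real and nonzero, so a real scaling, which preserves the directions,
normalises it to 1. -/
theorem exists_rolledCoamoeba_eq {θ : Fin 4 → ℙ ℝ ℂ} {v : Fin 3 → ℂ} (hv : v ∈ realLocus M θ)
    (hne : ∀ r, lineFunctional M r v ≠ 0) :
    ∃ (t : ℝ) (z : torusPart (affinePlane M)),
      planePoint M (t • v) = z.1 ∧ rolledCoamoeba _ z = θ := by
  have h4 := hne (Fin.last 4)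
  obtain ⟨hj, hi⟩ := mem_realLocus_iff.1 hv
  rw [lineFunctional_last] at h4 hi
  have hre : (((v 2).re : ℝ) : ℂ) = v 2 := Complex.ext (by simp) (by simp [hi])
  have hre0 : (v 2).re ≠ 0 := fun h => h4 (by rw [← hre, h, Complex.ofReal_zero])
  have ht : (((v 2).re⁻¹ : ℝ) : ℂ) * v 2 = 1 := by
    rw [Complex.ofReal_inv, hre, inv_mul_cancel₀ h4]
  have hp (j : Fin 4) : planePoint M ((v 2).re⁻¹ • v) j =
      (v 2).re⁻¹ • lineFunctional M j.castSucc v := by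
    rw [planePoint, LinearMap.map_smul_of_tower]
  have hz : planePoint M ((v 2).re⁻¹ • v) ∈ torusPart (affinePlane M) := by
    refine ⟨mem_affinePlane.2 ⟨_, ?_, rfl⟩, fun j => ?_⟩
    · simpa using ht
    · rw [hp]
      exact smul_ne_zero (inv_ne_zero hre0) (hne _)
  refine ⟨(v 2).re⁻¹, ⟨_, hz⟩, rfl, funext fun j => ?_⟩
  apply Projectivization.submodule_injective
  have hj' := hj j
  rw [Projectivization.submodule_eq, Submodule.mem_span_singleton] at hj'
  obtain ⟨a, ha⟩ := hj'
  have ha0 : a ≠ 0 := by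
    rintro rfl
    exact hne j.castSucc (by rw [← ha, zero_smul])
  rw [rolledCoamoeba, Projectivization.submodule_mk, (θ j).submodule_eq]
  simp only [hp, ← ha]
  rw [Submodule.span_singleton_smul_eq (inv_ne_zero hre0).isUnit,
    Submodule.span_singleton_smul_eq ha0.isUnit]

theorem IsGenericMatrix.criticalValues_eq (hM : IsGenericMatrix M)
    (hV : Module.finrank ℂ (affinePlane M).direction = 2) :
    criticalValues (affinePlane M) = {θ | HasRealPencil M θ} := by
  ext θ
  constructor
  · rintro ⟨z, hz, rfl⟩
    exact (hM.mem_criticalLocus_iff hV z).1 hz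
  · intro h
    obtain ⟨v, hv, hne⟩ := hM.exists_forall_ne_zero h
    obtain ⟨t, z, -, rfl⟩ := exists_rolledCoamoeba_eq hv hne
    exact ⟨z, (hM.mem_criticalLocus_iff hV z).2 h, rfl⟩

end

/-! ### A criterion for local triviality, and the circle as a real projective line -/

/-- A map from a compact space which is fibrewise bijective to `F` over an open set, by a function
continuous there, is trivial over that set. -/
theorem exists_trivialization_of_compactSpace {X B F : Type*} [TopologicalSpace X]
    [TopologicalSpace B] [TopologicalSpace F] [CompactSpace X] [T2Space B] [T2Space F] [Nonempty X]
    {π : X → B} (hπ : Continuous π) {U : Set B} (hU : IsOpen U) (φ : X → F)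
    (hφ : ContinuousOn φ (π ⁻¹' U)) (hb : ∀ b ∈ U, ∀ y, ∃! x, π x = b ∧ φ x = y) :
    ∃ t : Bundle.Trivialization F π, t.baseSet = U := by
  have hbij : Set.BijOn (fun x => (π x, φ x)) (π ⁻¹' U) (U ×ˢ Set.univ) := by
    refine ⟨fun x hx => ⟨hx, trivial⟩, fun x hx y hy hxy => ?_, fun q hq => ?_⟩
    · have h := Prod.mk.inj hxy
      exact (hb _ hx (φ x)).unique ⟨rfl, rfl⟩ ⟨h.1.symm, h.2.symm⟩
    · obtain ⟨x, hx, -⟩ := hb q.1 hq.1 q.2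
      exact ⟨x, by simpa [hx.1] using hq.1, Prod.ext hx.1 hx.2⟩
  let g : π ⁻¹' U → U × F := fun x => (⟨π x.1, x.2⟩, φ x.1)
  have hg : Continuous g :=
    ((hπ.comp continuous_subtype_val).subtype_mk _).prodMk
      (continuousOn_iff_continuous_domRestrict.1 hφ)
  -- Followed by the projection to U, g is a restriction of the proper map π; hence g itself is
  -- proper, and a closed continuous bijection.
  have hprop : IsProperMap g :=
    isProperMap_of_comp_of_t2 hg continuous_fst (hπ.isProperMap.restrictPreimage U)
  have hgb : Function.Bijective g := by
    refine ⟨fun x y hxy => Subtype.ext (hbij.injOn x.2 y.2 ?_), fun q => ?_⟩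
    · have h := Prod.mk.inj hxy
      exact Prod.ext (congrArg Subtype.val h.1) h.2
    · obtain ⟨x, hx, hxq⟩ := hbij.surjOn (show (q.1.1, q.2) ∈ U ×ˢ Set.univ from ⟨q.1.2, trivial⟩)
      have h := Prod.mk.inj hxq
      exact ⟨⟨x, hx⟩, Prod.ext (Subtype.ext h.1) h.2⟩
  have hopen : IsOpenMap g :=
    (Equiv.toHomeomorphOfContinuousClosed (Equiv.ofBijective g hgb) hg hprop.isClosedMap).isOpenMap
  have hopen' : IsOpenMap ((π ⁻¹' U).domRestrict fun x => (π x, φ x)) :=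
    (hU.isOpenMap_subtype_val.prodMap IsOpenMap.id).comp hopen
  let e := OpenPartialHomeomorph.ofContinuousOpenRestrict (hbij.toPartialEquiv _ _ _)
    (hπ.continuousOn.prodMk hφ) hopen' (hU.preimage hπ)
  exact ⟨{ e with
    baseSet := U
    open_baseSet := hU
    source_eq := rfl
    target_eq := rfl
    proj_toFun := fun p _ => rfl }, rfl⟩

/-- The quotients agree iff z / w is fixed by conjugation. Thus z ↦ conj z / z identifies the real
projective line of ℂ with the circle. -/
theorem Circle.ofConjDivSelf_eq_iff {z w : ℂ} (hz : z ≠ 0) (hw : w ≠ 0) :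
    Circle.ofConjDivSelf z hz = Circle.ofConjDivSelf w hw ↔ ∃ t : ℝ, t * w = z := by
  rw [← Circle.coe_inj]
  change starRingEnd ℂ z / z = starRingEnd ℂ w / w ↔ _
  constructor
  · intro h
    rw [div_eq_div_iff hz hw] at h
    have hc : starRingEnd ℂ (z / w) = z / w := by
      rw [map_div₀, div_eq_div_iff (by simpa using hw) hw]
      linear_combination h
    obtain ⟨t, ht⟩ := Complex.conj_eq_iff_real.1 hc
    exact ⟨t, by rw [← ht, div_mul_cancel₀ _ hw]⟩
  · rintro ⟨t, rfl⟩
    have ht : (t : ℂ) ≠ 0 := left_ne_zero_of_mul hz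
    rw [map_mul, Complex.conj_ofReal, mul_div_mul_left _ _ ht]

theorem Circle.exists_ofConjDivSelf_eq (y : Circle) :
    ∃ (z : ℂ) (hz : z ≠ 0), Circle.ofConjDivSelf z hz = y := by
  obtain ⟨s, rfl⟩ := Circle.exp_surjective y
  -- For z = exp(−i s / 2), conj z / z = exp(i s).
  refine ⟨Complex.exp (((-s / 2 : ℝ) : ℂ) * Complex.I), Complex.exp_ne_zero _, ?_⟩
  rw [← Circle.coe_inj]
  change starRingEnd ℂ _ / _ = _
  rw [← Complex.exp_conj, ← Complex.exp_sub, Circle.coe_exp, map_mul, Complex.conj_ofReal,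
    Complex.conj_I]
  congr 1
  push_cast
  ring

/-- The map to the circle induced by a real linear map to `ℂ`, with value `1` where it is not
defined. -/
def projCircleMap {E : Type*} [NormedAddCommGroup E] [NormedSpace ℝ E] (T : E →L[ℝ] ℂ)
    (p : ℙ ℝ E) : Circle :=
  if h : T p.rep ≠ 0 then Circle.ofConjDivSelf (T p.rep) h else 1

section

variable {E : Type*} [NormedAddCommGroup E] [NormedSpace ℝ E] (T : E →L[ℝ] ℂ)

theorem map_rep_ne_zero_iff {v : E} (hv : v ≠ 0) :
    T (Projectivization.mk ℝ v hv).rep ≠ 0 ↔ T v ≠ 0 := by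
  obtain ⟨a, ha⟩ := Projectivization.exists_smul_eq_mk_rep ℝ v hv
  rw [← ha, Units.smul_def, map_smul]
  simp

theorem projCircleMap_mk {v : E} (hv : v ≠ 0) (h : T v ≠ 0) :
    projCircleMap T (Projectivization.mk ℝ v hv) = Circle.ofConjDivSelf (T v) h := by
  have h' := (map_rep_ne_zero_iff T hv).2 h
  rw [projCircleMap, dif_pos h', Circle.ofConjDivSelf_eq_iff]
  obtain ⟨a, ha⟩ := Projectivization.exists_smul_eq_mk_rep ℝ v hv
  exact ⟨a, by rw [← ha, Units.smul_def, map_smul, Complex.real_smul]⟩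

theorem isOpen_map_rep_ne_zero : IsOpen {p : ℙ ℝ E | T p.rep ≠ 0} := by
  rw [← (Projectivization.isOpenQuotientMap_mk' (𝕜 := ℝ) (E := E)).isQuotientMap.isOpen_preimage]
  have : IsOpen {v : {v : E // v ≠ 0} | T v.1 ≠ 0} :=
    isOpen_ne_fun (T.continuous.comp continuous_subtype_val) continuous_const
  convert! this using 1
  ext v
  exact map_rep_ne_zero_iff T v.2

theorem continuousOn_projCircleMap : ContinuousOn (projCircleMap T) {p | T p.rep ≠ 0} := by
  rw [Projectivization.continuousOn_iff (isOpen_map_rep_ne_zero T),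
    continuousOn_iff_continuous_domRestrict]
  have hT (v : Projectivization.mk' ℝ ⁻¹' {p : ℙ ℝ E | T p.rep ≠ 0}) : T v.1.1 ≠ 0 :=
    (map_rep_ne_zero_iff T v.1.2).1 v.2
  have hc : Continuous fun v : Projectivization.mk' ℝ ⁻¹' {p : ℙ ℝ E | T p.rep ≠ 0} => T v.1.1 :=
    T.continuous.comp (continuous_subtype_val.comp continuous_subtype_val)
  refine continuous_induced_rng.2 (((Complex.continuous_conj.comp hc).div hc hT).congr fun v => ?_)
  change _ = ((projCircleMap T (Projectivization.mk ℝ v.1.1 v.1.2) : Circle) : ℂ)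
  rw [projCircleMap_mk T v.1.2 (hT v)]
  rfl

end

/-! ### Closedness of the incidence conditions -/

theorem rep_mem_iff {E : Type*} [AddCommGroup E] [Module ℝ E] (W : Submodule ℝ E) {v : E}
    (hv : v ≠ 0) : (Projectivization.mk ℝ v hv).rep ∈ W ↔ v ∈ W := by
  obtain ⟨a, ha⟩ := Projectivization.exists_smul_eq_mk_rep ℝ v hv
  rw [← ha, Units.smul_def, W.smul_mem_iff a.ne_zero]

theorem lineFunctional_rep_eq_zero_iff (M : Matrix (Fin 4) (Fin 3) ℂ) (r : Fin 5) {v : Fin 3 → ℂ}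
    (hv : v ≠ 0) : lineFunctional M r (Projectivization.mk ℝ v hv).rep = 0 ↔
      lineFunctional M r v = 0 :=
  rep_mem_iff (LinearMap.ker ((lineFunctional M r).restrictScalars ℝ)) hv

theorem isClosed_lineFunctional_rep_eq_zero (M : Matrix (Fin 4) (Fin 3) ℂ) (r : Fin 5) :
    IsClosed {p : ℙ ℝ (Fin 3 → ℂ) | lineFunctional M r p.rep = 0} := by
  rw [← (Projectivization.isOpenQuotientMap_mk' (𝕜 := ℝ)
    (E := Fin 3 → ℂ)).isQuotientMap.isClosed_preimage]
  have : IsClosed {v : {v : Fin 3 → ℂ // v ≠ 0} | lineFunctional M r v.1 = 0} :=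
    isClosed_eq ((continuous_lineFunctional M r).comp continuous_subtype_val) continuous_const
  convert! this using 1
  ext v
  exact lineFunctional_rep_eq_zero_iff M r v.2

theorem isClosed_rep_mem_realLocus (M : Matrix (Fin 4) (Fin 3) ℂ) :
    IsClosed {q : (Fin 4 → ℙ ℝ ℂ) × ℙ ℝ (Fin 3 → ℂ) | q.2.rep ∈ realLocus M q.1} := by
  have h := (IsOpenQuotientMap.id (X := Fin 4 → ℙ ℝ ℂ)).prodMap
    (Projectivization.isOpenQuotientMap_mk' (𝕜 := ℝ) (E := Fin 3 → ℂ))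
  rw [← h.isQuotientMap.isClosed_preimage]
  have : IsClosed (⋂ r, {q : (Fin 4 → ℙ ℝ ℂ) × {v : Fin 3 → ℂ // v ≠ 0} |
      lineFunctional M r q.2.1 ∈ (withRealAxis q.1 r).submodule}) :=
    isClosed_iInter fun r => isClosed_mem_submodule.preimage
      (((continuous_withRealAxis r).comp continuous_fst).prodMk
        ((continuous_lineFunctional M r).comp (continuous_subtype_val.comp continuous_snd)))
  convert! this using 1
  ext q
  simp only [Set.mem_preimage, Set.mem_iInter, Set.mem_ofPred_eq, ← mem_realLocus]
  exact rep_mem_iff _ q.2.2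

variable {M : Matrix (Fin 4) (Fin 3) ℂ}

/-- By `IsGenericMatrix.hasRealPencil_iff` the set is an intersection of five projections of closed
subsets of a compact space. -/
theorem IsGenericMatrix.isClosed_hasRealPencil (hM : IsGenericMatrix M) :
    IsClosed {θ | HasRealPencil M θ} := by
  have h (r : Fin 5) : IsClosed (Prod.fst '' ({q : (Fin 4 → ℙ ℝ ℂ) × ℙ ℝ (Fin 3 → ℂ) |
      q.2.rep ∈ realLocus M q.1} ∩ {q | lineFunctional M r q.2.rep = 0})) :=
    (((isClosed_rep_mem_realLocus M).inter ((isClosed_lineFunctional_rep_eq_zero M r).preimage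
      continuous_snd)).isCompact.image continuous_fst).isClosed
  convert! isClosed_iInter h using 1
  ext θ
  rw [Set.mem_ofPred_eq, hM.hasRealPencil_iff, Set.mem_iInter]
  refine forall_congr' fun r => ?_
  constructor
  · rintro ⟨v, hv, hv0, hr⟩
    exact ⟨(θ, Projectivization.mk ℝ v hv0), ⟨(rep_mem_iff _ hv0).2 hv,
      (lineFunctional_rep_eq_zero_iff M r hv0).2 hr⟩, rfl⟩
  · rintro ⟨⟨θ, p⟩, ⟨h1, h2⟩, rfl⟩
    exact ⟨p.rep, h1, p.rep_nonzero, h2⟩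

/-! ### The bundle of real projective lines, its sections and its trivialisations -/

variable {C : Set (Fin 4 → ℙ ℝ ℂ)}

/-- The bundle over a set of directions `θ` whose fibres are the real projective lines of the real
loci. -/
def PencilSpace (M : Matrix (Fin 4) (Fin 3) ℂ) (C : Set (Fin 4 → ℙ ℝ ℂ)) : Type :=
  {q : C × ℙ ℝ (Fin 3 → ℂ) // q.2.rep ∈ realLocus M q.1}

namespace PencilSpace

instance : TopologicalSpace (PencilSpace M C) :=
  inferInstanceAs (TopologicalSpace {q : C × ℙ ℝ (Fin 3 → ℂ) // q.2.rep ∈ realLocus M q.1})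

instance : T2Space (PencilSpace M C) :=
  inferInstanceAs (T2Space {q : C × ℙ ℝ (Fin 3 → ℂ) // q.2.rep ∈ realLocus M q.1})

/-- The projection to the base. -/
def proj (q : PencilSpace M C) : C := q.1.1

/-- The point of the real projective line. -/
def point (q : PencilSpace M C) : ℙ ℝ (Fin 3 → ℂ) := q.1.2

theorem continuous_proj : Continuous (proj : PencilSpace M C → C) :=
  continuous_fst.comp continuous_subtype_val

theorem continuous_point : Continuous (point : PencilSpace M C → ℙ ℝ (Fin 3 → ℂ)) :=
  continuous_snd.comp continuous_subtype_val

theorem rep_mem (q : PencilSpace M C) : q.point.rep ∈ realLocus M q.proj := q.2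

@[ext]
theorem ext {q q' : PencilSpace M C} (h : q.proj = q'.proj) (h' : q.point = q'.point) : q = q' :=
  Subtype.ext (Prod.ext h h')

/-- The point of the bundle given by a vector of a real locus. -/
def mk (c : C) (v : Fin 3 → ℂ) (hv0 : v ≠ 0) (hv : v ∈ realLocus M c) : PencilSpace M C :=
  ⟨(c, Projectivization.mk ℝ v hv0), (rep_mem_iff _ hv0).2 hv⟩

theorem point_mk (c : C) (v : Fin 3 → ℂ) (hv0 : v ≠ 0) (hv : v ∈ realLocus M c) :
    (mk c v hv0 hv).point = Projectivization.mk ℝ v hv0 := rfl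

theorem continuous_mk {X : Type*} [TopologicalSpace X] {c : X → C} {v : X → Fin 3 → ℂ}
    (hc : Continuous c) (hv : Continuous v) (hv0 : ∀ x, v x ≠ 0)
    (hm : ∀ x, v x ∈ realLocus M (c x)) : Continuous fun x => mk (c x) (v x) (hv0 x) (hm x) :=
  (hc.prodMk (Projectivization.continuous_mk'.comp (hv.subtype_mk hv0))).subtype_mk _

theorem isClosed_range_val : IsClosed {q : C × ℙ ℝ (Fin 3 → ℂ) | q.2.rep ∈ realLocus M q.1} :=
  (isClosed_rep_mem_realLocus M).preimage (f := fun q : C × ℙ ℝ (Fin 3 → ℂ) => (q.1.1, q.2))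
    ((continuous_subtype_val.comp continuous_fst).prodMk continuous_snd)

theorem compactSpace [CompactSpace C] : CompactSpace (PencilSpace M C) :=
  isCompact_iff_compactSpace.1 (isClosed_range_val (M := M) (C := C)).isCompact

theorem isClosed_lineFunctional_eq_zero (r : Fin 5) :
    IsClosed {q : PencilSpace M C | lineFunctional M r q.point.rep = 0} :=
  (isClosed_lineFunctional_rep_eq_zero M r).preimage continuous_point

end PencilSpace

/-- The point in the fibre over `c` where the functional number `r` vanishes. -/
def pencilSection (hC : ∀ c ∈ C, HasRealPencil M c) (r : Fin 5) (c : C) : PencilSpace M C :=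
  let h := (hC c c.2).exists_eq_zero r
  PencilSpace.mk c h.choose h.choose_spec.2.1 h.choose_spec.1

section

variable (hC : ∀ c ∈ C, HasRealPencil M c)

theorem lineFunctional_pencilSection (r : Fin 5) (c : C) :
    lineFunctional M r (pencilSection hC r c).point.rep = 0 :=
  (lineFunctional_rep_eq_zero_iff M r _).2 ((hC c c.2).exists_eq_zero r).choose_spec.2.2

theorem IsGenericMatrix.eq_pencilSection (hM : IsGenericMatrix M) {r : Fin 5}
    {q : PencilSpace M C} (hq : lineFunctional M r q.point.rep = 0) :
    q = pencilSection hC r q.proj := by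
  refine PencilSpace.ext rfl ?_
  rw [← q.point.mk_rep, ← (pencilSection hC r q.proj).point.mk_rep]
  exact hM.mk_eq_mk r q.rep_mem (pencilSection hC r q.proj).rep_mem hq
    (lineFunctional_pencilSection hC r _) _ _

theorem IsGenericMatrix.range_pencilSection (hM : IsGenericMatrix M) (r : Fin 5) :
    Set.range (pencilSection hC r) = {q | lineFunctional M r q.point.rep = 0} := by
  ext q
  constructor
  · rintro ⟨c, rfl⟩
    exact lineFunctional_pencilSection hC r c
  · intro h
    exact ⟨q.proj, (hM.eq_pencilSection hC h).symm⟩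

/-- The zero locus of ℓ_r is compact and projects bijectively onto the Hausdorff base; the section
is the inverse of this projection. -/
theorem IsGenericMatrix.continuous_pencilSection [CompactSpace C] (hM : IsGenericMatrix M)
    (r : Fin 5) : Continuous (pencilSection hC r) := by
  have : CompactSpace (PencilSpace M C) := PencilSpace.compactSpace
  have : CompactSpace {q : PencilSpace M C | lineFunctional M r q.point.rep = 0} :=
    isCompact_iff_compactSpace.1 (PencilSpace.isClosed_lineFunctional_eq_zero r).isCompact
  let f : {q : PencilSpace M C | lineFunctional M r q.point.rep = 0} ≃ C :=
    { toFun := fun q => q.1.proj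
      invFun := fun c => ⟨pencilSection hC r c, lineFunctional_pencilSection hC r c⟩
      left_inv := fun q => Subtype.ext (hM.eq_pencilSection hC q.2).symm
      right_inv := fun c => rfl }
  have hf : Continuous f := PencilSpace.continuous_proj.comp continuous_subtype_val
  exact continuous_subtype_val.comp (Continuous.continuous_symm_of_equiv_compact_to_t2 hf)

/-- The sections may meet over some θ; they differ as functions because of the special pencil of
`IsGenericMatrix.exists_hasRealPencil`, which C contains by `hC'`. -/
theorem IsGenericMatrix.pencilSection_injective (hM : IsGenericMatrix M)
    (hC' : ∀ θ, HasRealPencil M θ → θ ∈ C) : Function.Injective (pencilSection hC) := by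
  intro i j hij
  by_contra hne
  obtain ⟨θ, hθ, v, hv, hvi, hvj⟩ := hM.exists_hasRealPencil hne
  have hv0 : v ≠ 0 := by
    rintro rfl
    simp at hvj
  let q : PencilSpace M C := PencilSpace.mk ⟨θ, hC' θ hθ⟩ v hv0 hv
  have hq : q ∈ Set.range (pencilSection hC i) := by
    rw [hM.range_pencilSection]
    exact (lineFunctional_rep_eq_zero_iff M i hv0).2 hvi
  rw [hij, hM.range_pencilSection] at hq
  exact hvj ((lineFunctional_rep_eq_zero_iff M j hv0).1 hq)

theorem IsGenericMatrix.exists_pencilSection_ne (hM : IsGenericMatrix M) (c : C) :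
    ∃ i j, pencilSection hC i c ≠ pencilSection hC j c := by
  by_contra! h
  have hz (r : Fin 5) : lineFunctional M r (pencilSection hC 0 c).point.rep = 0 := by
    rw [h 0 r]
    exact lineFunctional_pencilSection hC r c
  exact Projectivization.rep_nonzero _ (eq_zero_of_lineFunctional_eq_zero
    (hM.1 0 1 2 (by decide) (by decide) (by decide)) (hz 0) (hz 1) (hz 2))

/-- Two of the functionals, in the directions `a` and `b`. -/
def realCoordinates (M : Matrix (Fin 4) (Fin 3) ℂ) (i j : Fin 5) (a b : ℂ) :
    (Fin 3 → ℂ) →L[ℝ] ℂ :=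
  LinearMap.toContinuousLinearMap
    { toFun := fun v => ⟨(lineFunctional M i v / a).re, (lineFunctional M j v / b).re⟩
      map_add' := fun u v => by
        apply Complex.ext <;> simp [add_div]
      map_smul' := fun t v => by
        apply Complex.ext <;> simp only [lineFunctional_real_smul, mul_div_assoc,
          Complex.re_ofReal_mul] <;> simp }

theorem realCoordinates_apply (i j : Fin 5) (a b : ℂ) (v : Fin 3 → ℂ) :
    realCoordinates M i j a b v =
      ⟨(lineFunctional M i v / a).re, (lineFunctional M j v / b).re⟩ := rfl

theorem re_div_ne_zero {θ : Fin 4 → ℙ ℝ ℂ} {v : Fin 3 → ℂ} (hv : v ∈ realLocus M θ) {i : Fin 5}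
    (hvi : lineFunctional M i v ≠ 0) {a : ℂ} (ha : ((withRealAxis θ i).rep / a).re ≠ 0) :
    (lineFunctional M i v / a).re ≠ 0 := by
  obtain ⟨x, hx⟩ := exists_real_of_mem_realLocus hv i
  have hx0 : x ≠ 0 := by
    rintro rfl
    simp [hx] at hvi
  rw [hx, mul_div_assoc, Complex.re_ofReal_mul]
  exact mul_ne_zero hx0 ha

/-- Near a point where two of the sections differ, the two corresponding functionals are
coordinates on the fibres. -/
theorem IsGenericMatrix.exists_trivialization [CompactSpace C] (hM : IsGenericMatrix M)
    (hC : ∀ c ∈ C, HasRealPencil M c) (c : C) :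
    ∃ t : Bundle.Trivialization Circle (PencilSpace.proj : PencilSpace M C → C),
      c ∈ t.baseSet := by
  have : CompactSpace (PencilSpace M C) := PencilSpace.compactSpace
  obtain ⟨i, j, hij⟩ := hM.exists_pencilSection_ne hC c
  set a : Fin 5 → ℂ := fun r => (withRealAxis c r).rep with ha
  have ha0 (r : Fin 5) : a r ≠ 0 := Projectivization.rep_nonzero _
  -- Over N r the r-th direction is not perpendicular to the fixed a r, so taking the real part
  -- after division by a r is injective on it.
  let N (r : Fin 5) : Set C := {b | ((withRealAxis b r).rep / a r).re ≠ 0}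
  have hN (r : Fin 5) : IsOpen (N r) := (isOpen_rep_re_ne_zero (a r)).preimage
    ((continuous_withRealAxis r).comp continuous_subtype_val)
  have hcN (r : Fin 5) : c ∈ N r := by
    change (a r / a r).re ≠ 0
    rw [div_self (ha0 r), Complex.one_re]
    exact one_ne_zero
  let U : Set C := {b | pencilSection hC i b ≠ pencilSection hC j b} ∩ (N i ∩ N j)
  have hU : IsOpen U := (isOpen_ne_fun (hM.continuous_pencilSection hC i)
    (hM.continuous_pencilSection hC j)).inter ((hN i).inter (hN j))
  set T := realCoordinates M i j (a i) (a j) with hT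
  -- The points of the two sections form a basis v, w of the real locus with ℓ_i(v) = 0 = ℓ_j(w). In
  -- this basis T is antidiagonal with nonzero entries, hence an isomorphism onto ℂ.
  have hbasis : ∀ b ∈ U, ∃ v ∈ realLocus M b, ∃ w ∈ realLocus M b, ∃ α β : ℝ, α ≠ 0 ∧ β ≠ 0 ∧
      (∀ x y : ℝ, T (x • v + y • w) = ⟨y * α, x * β⟩) ∧
      ∀ u ∈ realLocus M b, ∃ x y : ℝ, u = x • v + y • w := by
    rintro b ⟨hb, hbi, hbj⟩
    have hv := (pencilSection hC i b).rep_mem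
    have hw := (pencilSection hC j b).rep_mem
    have hvi := lineFunctional_pencilSection hC i b
    have hwj := lineFunctional_pencilSection hC j b
    have hvj : lineFunctional M j (pencilSection hC i b).point.rep ≠ 0 := fun h =>
      hb (hM.eq_pencilSection hC h)
    have hwi : lineFunctional M i (pencilSection hC j b).point.rep ≠ 0 := fun h =>
      hb (hM.eq_pencilSection hC h).symm
    refine ⟨_, hv, _, hw, _, _, re_div_ne_zero hw hwi hbi, re_div_ne_zero hv hvj hbj,
      fun x y => ?_, fun u hu => hM.exists_eq_add hv hw hu (Projectivization.rep_nonzero _) hvi hwi⟩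
    rw [map_add, map_smul, map_smul, hT, realCoordinates_apply, realCoordinates_apply, hvi, hwj]
    apply Complex.ext <;> simp
  have hTne : ∀ b ∈ U, ∀ u ∈ realLocus M b, T u = 0 → u = 0 := by
    intro b hb u hu h0
    obtain ⟨v, hv, w, hw, α, β, hα, hβ, hform, hspan⟩ := hbasis b hb
    obtain ⟨x, y, rfl⟩ := hspan u hu
    rw [hform] at h0
    have h1 := congrArg Complex.re h0
    have h2 := congrArg Complex.im h0
    simp only [Complex.zero_re, Complex.zero_im, mul_eq_zero, hα, hβ, or_false] at h1 h2
    rw [h1, h2, zero_smul, zero_smul, add_zero]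
  have hTrep : ∀ q : PencilSpace M C, q.proj ∈ U → T q.point.rep ≠ 0 := fun q hq h0 =>
    q.point.rep_nonzero (hTne _ hq _ q.rep_mem h0)
  have : Nonempty (PencilSpace M C) := ⟨pencilSection hC 0 c⟩
  have hbij : ∀ b ∈ U, ∀ y, ∃! q : PencilSpace M C, q.proj = b ∧ projCircleMap T q.point = y := by
    intro b hb y
    obtain ⟨v, hv, w, hw, α, β, hα, hβ, hform, hspan⟩ := hbasis b hb
    obtain ⟨z, hz, rfl⟩ := Circle.exists_ofConjDivSelf_eq y
    -- The preimage of z under T in the real locus over b.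
    set u := (z.im / β) • v + (z.re / α) • w with hu
    have hTu : T u = z := by
      rw [hu, hform]
      apply Complex.ext <;> field_simp
    have hu0 : u ≠ 0 := by
      intro h0
      rw [h0, map_zero] at hTu
      exact hz hTu.symm
    have hum : u ∈ realLocus M b := Submodule.add_mem _ (Submodule.smul_mem _ _ hv)
      (Submodule.smul_mem _ _ hw)
    refine ⟨PencilSpace.mk b u hu0 hum, ⟨rfl, ?_⟩, ?_⟩
    · rw [PencilSpace.point_mk, projCircleMap_mk T hu0 (by rwa [hTu])]
      simp only [hTu]
    · rintro q ⟨rfl, hq⟩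
      have hqT := hTrep q hb
      rw [← q.point.mk_rep, projCircleMap_mk T q.point.rep_nonzero hqT,
        Circle.ofConjDivSelf_eq_iff] at hq
      obtain ⟨t, ht⟩ := hq
      have h0 : q.point.rep - t • u = 0 := hTne _ hb _
        (Submodule.sub_mem _ q.rep_mem (Submodule.smul_mem _ t hum))
        (by rw [map_sub, map_smul, hTu, Complex.real_smul, ht, sub_self])
      refine PencilSpace.ext rfl ?_
      rw [PencilSpace.point_mk, ← q.point.mk_rep, Projectivization.mk_eq_mk_iff']
      exact ⟨t, (sub_eq_zero.1 h0).symm⟩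
  obtain ⟨t, ht⟩ := exists_trivialization_of_compactSpace
    (π := (PencilSpace.proj : PencilSpace M C → C)) PencilSpace.continuous_proj hU
    (fun q => projCircleMap T q.point)
    ((continuousOn_projCircleMap T).comp PencilSpace.continuous_point.continuousOn hTrep) hbij
  exact ⟨t, ht ▸ ⟨hij, hcN i, hcN j⟩⟩
end

/-! ### The critical locus inside the bundle -/

section

variable {M : Matrix (Fin 4) (Fin 3) ℂ} {C : Set (Fin 4 → ℙ ℝ ℂ)}

/-- The homogeneous coordinates of a point of the plane, computed from its first three
coordinates in `ℂ⁴`. -/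
def homogeneousCoordinates (M : Matrix (Fin 4) (Fin 3) ℂ) (z : Fin 4 → ℂ) : Fin 3 → ℂ :=
  (Matrix.of ![M 0, M 1, M 2])⁻¹.mulVec ![z 0, z 1, z 2]

theorem continuous_homogeneousCoordinates : Continuous (homogeneousCoordinates M) := by
  refine Continuous.matrix_mulVec continuous_const (continuous_pi fun i => ?_)
  fin_cases i
  exacts [continuous_apply 0, continuous_apply 1, continuous_apply 2]

theorem IsGenericMatrix.homogeneousCoordinates_planePoint (hM : IsGenericMatrix M)
    (u : Fin 3 → ℂ) : homogeneousCoordinates M (planePoint M u) = u := by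
  have hdet : (Matrix.of ![M 0, M 1, M 2]).det ≠ 0 :=
    hM.1 0 1 2 (by decide) (by decide) (by decide)
  have h : ![planePoint M u 0, planePoint M u 1, planePoint M u 2] =
      (Matrix.of ![M 0, M 1, M 2]).mulVec u := by
    ext i
    fin_cases i <;> rfl
  rw [homogeneousCoordinates, h, Matrix.mulVec_mulVec,
    Matrix.nonsing_inv_mul _ (isUnit_iff_ne_zero.2 hdet), Matrix.one_mulVec]

theorem IsGenericMatrix.homogeneousCoordinates_spec (hM : IsGenericMatrix M)
    (z : torusPart (affinePlane M)) : homogeneousCoordinates M z.1 2 = 1 ∧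
      planePoint M (homogeneousCoordinates M z.1) = z.1 := by
  obtain ⟨u, hu, huz⟩ := mem_affinePlane.1 z.2.1
  rw [← huz, hM.homogeneousCoordinates_planePoint]
  exact ⟨hu, rfl⟩

theorem continuous_rolledCoamoeba (V : AffineSubspace ℂ (Fin 4 → ℂ)) :
    Continuous (rolledCoamoeba V) :=
  continuous_pi fun j => Projectivization.continuous_mk'.comp
    (((continuous_apply j).comp continuous_subtype_val).subtype_mk fun z => z.2.2 j)

/-- The inclusion of the critical locus in the bundle of real lines. -/
def criticalInclusion (hM : IsGenericMatrix M) (z : criticalLocus (affinePlane M)) :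
    PencilSpace M (criticalValues (affinePlane M)) :=
  PencilSpace.mk ⟨rolledCoamoeba _ z.1, z.1, z.2, rfl⟩ (homogeneousCoordinates M z.1.1)
    (fun h => by simpa [h] using (hM.homogeneousCoordinates_spec z.1).1)
    (mem_realLocus_of_planePoint_eq z.1 (hM.homogeneousCoordinates_spec z.1).1
      (hM.homogeneousCoordinates_spec z.1).2)

theorem continuous_criticalInclusion (hM : IsGenericMatrix M) :
    Continuous (criticalInclusion hM) :=
  PencilSpace.continuous_mk
    (((continuous_rolledCoamoeba _).comp continuous_subtype_val).subtype_mk _)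
    (continuous_homogeneousCoordinates.comp (continuous_subtype_val.comp continuous_subtype_val))
    _ _

/-- A continuous system of coordinates which determines a vector up to complex multiples if its
last coordinate does not vanish. -/
def hermitianCoordinates : ℙ ℝ (Fin 3 → ℂ) → Fin 3 → ℂ :=
  Projectivization.lift (fun v => (((‖v.1‖ ^ 2 : ℝ) : ℂ)⁻¹ * starRingEnd ℂ (v.1 2)) • v.1) <| by
    rintro ⟨a, ha⟩ b t rfl
    have ht : t ≠ 0 := left_ne_zero_of_smul ha
    have ht' : (t : ℂ) ≠ 0 := Complex.ofReal_ne_zero.2 ht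
    have hb : ((‖b.1‖ : ℝ) : ℂ) ≠ 0 := Complex.ofReal_ne_zero.2 (norm_ne_zero_iff.2 b.2)
    ext i
    simp only [norm_smul, mul_pow, Real.norm_eq_abs, sq_abs, Pi.smul_apply, Complex.real_smul,
      map_mul, Complex.conj_ofReal, smul_eq_mul]
    push_cast
    field_simp

theorem continuous_hermitianCoordinates : Continuous hermitianCoordinates := by
  rw [← Projectivization.isOpenQuotientMap_mk'.continuous_comp_iff]
  have h : Continuous fun v : {v : Fin 3 → ℂ // v ≠ 0} =>
      (((‖v.1‖ ^ 2 : ℝ) : ℂ)⁻¹ * starRingEnd ℂ (v.1 2)) • v.1 := by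
    have hn : Continuous fun v : {v : Fin 3 → ℂ // v ≠ 0} => ((‖v.1‖ ^ 2 : ℝ) : ℂ) :=
      Complex.continuous_ofReal.comp (continuous_subtype_val.norm.pow 2)
    have h2 : Continuous fun v : {v : Fin 3 → ℂ // v ≠ 0} => v.1 2 :=
      (continuous_apply 2).comp continuous_subtype_val
    exact ((hn.inv₀ fun v => Complex.ofReal_ne_zero.2 (pow_ne_zero _ (norm_ne_zero_iff.2 v.2))).mul
      (Complex.continuous_conj.comp h2)).smul continuous_subtype_val
  exact h

/-- Dividing the hermitian coordinates by the last of them recovers the vector with w = 1, hence the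
point of ℂ⁴. So the inclusion of the critical locus in ℂ⁴ factors continuously through this map on
its image. -/
theorem isEmbedding_criticalInclusion (hM : IsGenericMatrix M) :
    Topology.IsEmbedding (criticalInclusion hM) := by
  have hcoord (z : criticalLocus (affinePlane M)) :
      hermitianCoordinates (criticalInclusion hM z).point =
        (((‖homogeneousCoordinates M z.1.1‖ ^ 2 : ℝ) : ℂ)⁻¹ *
          starRingEnd ℂ (homogeneousCoordinates M z.1.1 2)) • homogeneousCoordinates M z.1.1 := rfl
  have hne (z : criticalLocus (affinePlane M)) :
      hermitianCoordinates (criticalInclusion hM z).point 2 ≠ 0 := by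
    have h2 := (hM.homogeneousCoordinates_spec z.1).1
    have h0 : homogeneousCoordinates M z.1.1 ≠ 0 := fun h => by simp [h] at h2
    rw [hcoord, Pi.smul_apply, h2]
    simpa using h0
  let h : criticalLocus (affinePlane M) → {g : Fin 3 → ℂ // g 2 ≠ 0} := fun z => ⟨_, hne z⟩
  let ψ : {g : Fin 3 → ℂ // g 2 ≠ 0} → Fin 4 → ℂ := fun g => planePoint M ((g.1 2)⁻¹ • g.1)
  have hcont : Continuous (hermitianCoordinates ∘ PencilSpace.point ∘ criticalInclusion hM) :=
    continuous_hermitianCoordinates.comp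
      (PencilSpace.continuous_point.comp (continuous_criticalInclusion hM))
  have hh : Continuous h := hcont.subtype_mk _
  have hψ : Continuous ψ := by
    have h2 : Continuous fun g : {g : Fin 3 → ℂ // g 2 ≠ 0} => g.1 2 :=
      (continuous_apply 2).comp continuous_subtype_val
    exact continuous_pi fun j => (continuous_lineFunctional M j.castSucc).comp
      ((h2.inv₀ fun g => g.2).smul continuous_subtype_val)
  have hcomp : ψ ∘ h = fun z => z.1.1 := by
    funext z
    obtain ⟨h2, hp⟩ := hM.homogeneousCoordinates_spec z.1
    have h0 : homogeneousCoordinates M z.1.1 ≠ 0 := fun h => by simp [h] at h2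
    have hn : (((‖homogeneousCoordinates M z.1.1‖ ^ 2 : ℝ) : ℂ)⁻¹) ≠ 0 :=
      inv_ne_zero (Complex.ofReal_ne_zero.2 (pow_ne_zero _ (norm_ne_zero_iff.2 h0)))
    change planePoint M ((hermitianCoordinates (criticalInclusion hM z).point 2)⁻¹ •
      hermitianCoordinates (criticalInclusion hM z).point) = _
    rw [hcoord, Pi.smul_apply, h2, map_one, mul_one, smul_smul, smul_eq_mul, mul_one,
      inv_mul_cancel₀ hn, one_smul, hp]
  have hemb : Topology.IsEmbedding h := by
    refine Topology.IsEmbedding.of_comp hh hψ ?_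
    rw [hcomp]
    exact Topology.IsEmbedding.subtypeVal.comp Topology.IsEmbedding.subtypeVal
  exact Topology.IsEmbedding.of_comp (continuous_criticalInclusion hM)
    (continuous_hermitianCoordinates.comp PencilSpace.continuous_point)
    (Topology.IsEmbedding.subtypeVal.comp hemb)

theorem IsGenericMatrix.range_criticalInclusion (hM : IsGenericMatrix M)
    (hV : Module.finrank ℂ (affinePlane M).direction = 2) :
    Set.range (criticalInclusion hM) = {q | ∀ r, lineFunctional M r q.point.rep ≠ 0} := by
  ext q
  constructor
  · rintro ⟨z, rfl⟩ r
    rw [criticalInclusion, PencilSpace.point_mk, Ne, lineFunctional_rep_eq_zero_iff]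
    obtain ⟨h2, hp⟩ := hM.homogeneousCoordinates_spec z.1
    induction r using Fin.lastCases with
    | last =>
      rw [lineFunctional_last, h2]
      exact one_ne_zero
    | cast j =>
      have := congrFun hp j
      rw [planePoint] at this
      rw [this]
      exact z.1.2.2 j
  · intro h
    obtain ⟨t, z, hz, hθ⟩ := exists_rolledCoamoeba_eq q.rep_mem h
    have hcrit : z ∈ criticalLocus (affinePlane M) := by
      rw [hM.mem_criticalLocus_iff hV, hθ]
      exact (hM.criticalValues_eq hV).subset q.proj.2
    refine ⟨⟨z, hcrit⟩, PencilSpace.ext (Subtype.ext hθ) ?_⟩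
    rw [criticalInclusion, PencilSpace.point_mk, ← q.point.mk_rep, Projectivization.mk_eq_mk_iff']
    exact ⟨t, by rw [← hz, hM.homogeneousCoordinates_planePoint]⟩

/-- Within its fibre, a point on a section is moved along q + t v with v off all five lines; only
finitely many t give a point on a section. -/
theorem IsGenericMatrix.denseRange_criticalInclusion (hM : IsGenericMatrix M)
    (hV : Module.finrank ℂ (affinePlane M).direction = 2) :
    DenseRange (criticalInclusion hM) := by
  intro q
  by_cases hq : q ∈ Set.range (criticalInclusion hM)
  · exact subset_closure hq
  have hrange := hM.range_criticalInclusion hV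
  rw [hrange, Set.mem_ofPred_eq] at hq
  push Not at hq
  obtain ⟨r, hr⟩ := hq
  have hpencil : HasRealPencil M q.proj := (hM.criticalValues_eq hV).subset q.proj.2
  obtain ⟨v, hv, hv0⟩ := hM.exists_forall_ne_zero hpencil
  have hne (t : ℝ) : q.point.rep + t • v ≠ 0 := by
    intro h
    have h' := congrArg (lineFunctional M r) h
    rw [map_add, hr, zero_add, lineFunctional_real_smul, map_zero] at h'
    have ht : t = 0 := by simpa [hv0 r] using h'
    rw [ht, zero_smul, add_zero] at h
    exact q.point.rep_nonzero h
  let g : ℝ → PencilSpace M (criticalValues (affinePlane M)) := fun t =>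
    PencilSpace.mk q.proj (q.point.rep + t • v) (hne t)
      (Submodule.add_mem _ q.rep_mem (Submodule.smul_mem _ t hv))
  have hg : Continuous g := PencilSpace.continuous_mk continuous_const
    (continuous_const.add (continuous_id.smul continuous_const)) hne _
  have hg0 : g 0 = q := by
    refine PencilSpace.ext rfl ?_
    rw [PencilSpace.point_mk]
    simp
  have hfin : (⋃ r, {t : ℝ | lineFunctional M r q.point.rep +
      t * lineFunctional M r v = 0}).Finite :=
    Set.finite_iUnion fun r => finite_setOf_add_smul_eq_zero fun h0 => hv0 r h0.2
  have hdense := hfin.countable.dense_compl ℝ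
  rw [← hg0]
  refine map_mem_closure hg (hdense 0) fun t ht => ?_
  rw [hrange]
  intro s hs
  rw [PencilSpace.point_mk, lineFunctional_rep_eq_zero_iff, map_add, lineFunctional_real_smul] at hs
  exact ht (Set.mem_iUnion.2 ⟨s, hs⟩)

/-! ### The map to ℂP⁴ -/

theorem lineFunctional_ne_zero (hM : IsGenericMatrix M) {v : Fin 3 → ℂ} (hv : v ≠ 0) :
    (fun r => lineFunctional M r v) ≠ 0 := fun h => hv
  (eq_zero_of_lineFunctional_eq_zero (hM.1 0 1 2 (by decide) (by decide) (by decide))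
    (congrFun h 0) (congrFun h 1) (congrFun h 2))

/-- The map `ℂ³ → ℂ⁵` given by the five functionals, on the real projectivisation. -/
def projectiveMap (hM : IsGenericMatrix M) : ℙ ℝ (Fin 3 → ℂ) → ℙ ℂ (Fin 5 → ℂ) := fun p =>
  Projectivization.mk ℂ (fun r => lineFunctional M r p.rep) (lineFunctional_ne_zero hM p.rep_nonzero)

theorem projectiveMap_mk (hM : IsGenericMatrix M) {v : Fin 3 → ℂ} (hv : v ≠ 0) :
    projectiveMap hM (Projectivization.mk ℝ v hv) =
      Projectivization.mk ℂ (fun r => lineFunctional M r v) (lineFunctional_ne_zero hM hv) := by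
  obtain ⟨a, ha⟩ := Projectivization.exists_smul_eq_mk_rep ℝ v hv
  refine (Projectivization.mk_eq_mk_iff' _ _ _ _ _).2 ⟨((a : ℝ) : ℂ), funext fun r => ?_⟩
  rw [← ha, Units.smul_def, lineFunctional_real_smul]
  rfl

theorem continuous_projectiveMap (hM : IsGenericMatrix M) : Continuous (projectiveMap hM) := by
  rw [← Projectivization.isOpenQuotientMap_mk'.continuous_comp_iff]
  have h : Continuous fun v : {v : Fin 3 → ℂ // v ≠ 0} => Projectivization.mk' ℂ
      (⟨fun r => lineFunctional M r v.1, lineFunctional_ne_zero hM v.2⟩ :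
        {w : Fin 5 → ℂ // w ≠ 0}) :=
    Projectivization.continuous_mk'.comp ((continuous_pi fun r =>
      (continuous_lineFunctional M r).comp continuous_subtype_val).subtype_mk _)
  exact h.congr fun v => (projectiveMap_mk hM v.2).symm

theorem projectiveMap_mem_coordHyperplane_iff (hM : IsGenericMatrix M) (p : ℙ ℝ (Fin 3 → ℂ))
    (r : Fin 5) : projectiveMap hM p ∈ coordHyperplane r ↔ lineFunctional M r p.rep = 0 := by
  rw [coordHyperplane, Set.mem_ofPred_eq, projectiveMap, Projectivization.submodule_mk]
  constructor
  · exact fun h => h _ (Submodule.mem_span_singleton_self _)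
  · intro h v hv
    obtain ⟨a, rfl⟩ := Submodule.mem_span_singleton.1 hv
    simp [h]

theorem projectiveMap_criticalInclusion (hM : IsGenericMatrix M)
    (z : criticalLocus (affinePlane M)) :
    projectiveMap hM (criticalInclusion hM z).point = toProj z.1.1 := by
  rw [criticalInclusion, PencilSpace.point_mk, projectiveMap_mk, toProj]
  obtain ⟨h2, hp⟩ := hM.homogeneousCoordinates_spec z.1
  congr 1
  funext r
  induction r using Fin.lastCases with
  | last => rw [lineFunctional_last, h2, Fin.snoc_last]
  | cast j =>
    rw [Fin.snoc_castSucc]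
    exact congrFun hp j

end

/-! ### Genericity as a real polynomial condition -/

/-- A complex-valued function of a complex matrix which is a polynomial in the real and imaginary
parts of the entries. -/
def IsRealPolynomial {m n : Type*} (f : Matrix m n ℂ → ℂ) : Prop :=
  ∃ p q : MvPolynomial ((m × n) ⊕ (m × n)) ℝ, ∀ M : Matrix m n ℂ,
    (f M).re = MvPolynomial.eval (Sum.elim (fun p => (M p.1 p.2).re) fun p => (M p.1 p.2).im) p ∧
    (f M).im = MvPolynomial.eval (Sum.elim (fun p => (M p.1 p.2).re) fun p => (M p.1 p.2).im) q

namespace IsRealPolynomial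

variable {m n : Type*} {f g : Matrix m n ℂ → ℂ}

theorem const (c : ℂ) : IsRealPolynomial fun _ : Matrix m n ℂ => c :=
  ⟨MvPolynomial.C c.re, MvPolynomial.C c.im, fun M => by simp⟩

theorem entry (i : m) (j : n) : IsRealPolynomial fun M : Matrix m n ℂ => M i j :=
  ⟨MvPolynomial.X (Sum.inl (i, j)), MvPolynomial.X (Sum.inr (i, j)), fun M => by simp⟩

theorem add (hf : IsRealPolynomial f) (hg : IsRealPolynomial g) :
    IsRealPolynomial fun M => f M + g M := by
  obtain ⟨p, q, h⟩ := hf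
  obtain ⟨p', q', h'⟩ := hg
  exact ⟨p + p', q + q', fun M => by simp [h, h']⟩

theorem sub (hf : IsRealPolynomial f) (hg : IsRealPolynomial g) :
    IsRealPolynomial fun M => f M - g M := by
  obtain ⟨p, q, h⟩ := hf
  obtain ⟨p', q', h'⟩ := hg
  exact ⟨p - p', q - q', fun M => by simp [h, h']⟩

theorem mul (hf : IsRealPolynomial f) (hg : IsRealPolynomial g) :
    IsRealPolynomial fun M => f M * g M := by
  obtain ⟨p, q, h⟩ := hf
  obtain ⟨p', q', h'⟩ := hg
  exact ⟨p * p' - q * q', p * q' + q * p', fun M => by simp [h, h']⟩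

theorem conj (hf : IsRealPolynomial f) : IsRealPolynomial fun M => starRingEnd ℂ (f M) := by
  obtain ⟨p, q, h⟩ := hf
  exact ⟨p, -q, fun M => by simp [h]⟩

end IsRealPolynomial

theorem isRealPolynomial_lineForm (r : Fin 5) (i : Fin 3) :
    IsRealPolynomial fun M : Matrix (Fin 4) (Fin 3) ℂ => lineForm M r i := by
  unfold lineForm
  induction r using Fin.lastCases with
  | last => simpa only [Fin.snoc_last] using IsRealPolynomial.const _
  | cast j => simpa only [Fin.snoc_castSucc] using IsRealPolynomial.entry j i

theorem isRealPolynomial_bracket (i j k : Fin 5) :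
    IsRealPolynomial fun M : Matrix (Fin 4) (Fin 3) ℂ => bracket M i j k := by
  have h := isRealPolynomial_lineForm
  simp only [bracket, Matrix.det_fin_three]
  exact ((((((((h i 0).mul (h j 1)).mul (h k 2)).sub (((h i 0).mul (h j 2)).mul (h k 1))).sub
    (((h i 1).mul (h j 0)).mul (h k 2))).add (((h i 1).mul (h j 2)).mul (h k 0))).add
    (((h i 2).mul (h j 0)).mul (h k 1))).sub (((h i 2).mul (h j 1)).mul (h k 0)))

/-- The numerator of the imaginary part of a cross-ratio. -/
def crossRatioNumerator (M : Matrix (Fin 4) (Fin 3) ℂ) (m i j k l : Fin 5) : ℂ :=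
  (bracket M m i k * bracket M m j l) * starRingEnd ℂ (bracket M m i l * bracket M m j k)

theorem isRealPolynomial_crossRatioNumerator (m i j k l : Fin 5) :
    IsRealPolynomial fun M => crossRatioNumerator M m i j k l :=
  ((isRealPolynomial_bracket m i k).mul (isRealPolynomial_bracket m j l)).mul
    ((isRealPolynomial_bracket m i l).mul (isRealPolynomial_bracket m j k)).conj

/-- Numerator times conjugate denominator is the cross-ratio up to a positive real factor. Every
bracket of distinct indices is a factor of such a product, so the condition on the imaginary parts
also excludes concurrent lines. -/
theorem isGenericMatrix_of_crossRatioNumerator {M : Matrix (Fin 4) (Fin 3) ℂ}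
    (h : ∀ σ : Equiv.Perm (Fin 5),
      (crossRatioNumerator M (σ 0) (σ 1) (σ 2) (σ 3) (σ 4)).im ≠ 0) : IsGenericMatrix M := by
  constructor
  · intro i j k hij hik hjk h0
    -- The order i, j, l, k, m puts i, j, k in positions 0, 1, 3, those of the first bracket of the
    -- numerator.
    have hidx : ∀ i j k : Fin 5, i ≠ j → i ≠ k → j ≠ k →
        ∃ l m, Function.Injective ![i, j, l, k, m] := by decide +kernel
    obtain ⟨l, m, hinj⟩ := hidx i j k hij hik hjk
    refine h (Equiv.ofBijective _ (Finite.injective_iff_bijective.1 hinj)) ?_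
    have h0' : bracket M (![i, j, l, k, m] 0) (![i, j, l, k, m] 1) (![i, j, l, k, m] 3) = 0 := h0
    simp only [Equiv.ofBijective_apply, crossRatioNumerator, h0', zero_mul, Complex.zero_im]
  · intro σ
    have hσ := h σ
    have hD : bracket M (σ 0) (σ 1) (σ 4) * bracket M (σ 0) (σ 2) (σ 3) ≠ 0 := by
      intro h0
      simp [crossRatioNumerator, h0] at hσ
    rw [lineCrossRatio]
    have : (bracket M (σ 0) (σ 1) (σ 3) * bracket M (σ 0) (σ 2) (σ 4)) /
        (bracket M (σ 0) (σ 1) (σ 4) * bracket M (σ 0) (σ 2) (σ 3)) =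
        ((Complex.normSq (bracket M (σ 0) (σ 1) (σ 4) * bracket M (σ 0) (σ 2) (σ 3)))⁻¹ : ℝ) *
          crossRatioNumerator M (σ 0) (σ 1) (σ 2) (σ 3) (σ 4) := by
      rw [crossRatioNumerator, div_eq_mul_inv, Complex.inv_def]
      ring
    rw [this, Complex.im_ofReal_mul]
    exact mul_ne_zero (inv_ne_zero (by simpa [Complex.normSq_eq_zero] using hD)) hσ

theorem finrank_direction_affinePlane {M : Matrix (Fin 4) (Fin 3) ℂ} (hM : IsGenericMatrix M) :
    Module.finrank ℂ (affinePlane M).direction = 2 := by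
  rw [affinePlane, AffineSubspace.direction_mk']
  have hl : LinearIndependent ℂ ![(fun j => M j 0 : Fin 4 → ℂ), fun j => M j 1] := by
    rw [LinearIndependent.pair_iff]
    intro s t h
    have hz : ![s, t, 0] = 0 := by
      refine hM.planePoint_injective (funext fun j => ?_)
      have := congrFun h j
      simp only [Pi.add_apply, Pi.smul_apply, smul_eq_mul, Pi.zero_apply] at this
      simp only [planePoint, lineFunctional_castSucc, map_zero, Matrix.cons_val_zero,
        Matrix.cons_val_one, Matrix.cons_val]
      linear_combination this
    exact ⟨congrFun hz 0, congrFun hz 1⟩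
  have := finrank_span_eq_card hl
  rwa [Matrix.range_cons, Matrix.range_cons, Matrix.range_empty, Set.union_empty,
    Fintype.card_fin] at this

/-- The five linear forms of the plane `(x, y) ↦ (x, y, x + y - 1, x + i y - (1 + 2 i))`. -/
def exampleForm : Fin 5 → Fin 3 → GaussianInt :=
  ![![1, 0, 0], ![0, 1, 0], ![1, 1, -1], ![1, ⟨0, 1⟩, ⟨-1, -2⟩], ![0, 0, 1]]

/-- The determinant of three of the forms of the example. -/
def exampleBracket (i j k : Fin 5) : GaussianInt :=
  let F := exampleForm
  F i 0 * F j 1 * F k 2 - F i 0 * F j 2 * F k 1 - F i 1 * F j 0 * F k 2 + F i 1 * F j 2 * F k 0 +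
    F i 2 * F j 0 * F k 1 - F i 2 * F j 1 * F k 0

/-- The parameters of the example. -/
def exampleMatrix : Matrix (Fin 4) (Fin 3) ℂ :=
  Matrix.of fun j i => (exampleForm j.castSucc i : ℂ)

theorem lineForm_exampleMatrix (r : Fin 5) (i : Fin 3) :
    lineForm exampleMatrix r i = (exampleForm r i : ℂ) := by
  unfold lineForm
  induction r using Fin.lastCases with
  | last =>
    rw [Fin.snoc_last]
    fin_cases i <;> simp [exampleForm, Fin.last]
  | cast j =>
    rw [Fin.snoc_castSucc]
    rfl

theorem bracket_exampleMatrix (i j k : Fin 5) :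
    bracket exampleMatrix i j k = (exampleBracket i j k : ℂ) := by
  rw [bracket, Matrix.det_fin_three, exampleBracket]
  simp only [map_add, map_sub, map_mul, ← lineForm_exampleMatrix]
  rfl

/-- The forms of the example have Gaussian integer coefficients, so this is a finite check in exact
integer arithmetic. -/
theorem crossRatioNumerator_exampleMatrix_im_ne_zero (σ : Equiv.Perm (Fin 5)) :
    (crossRatioNumerator exampleMatrix (σ 0) (σ 1) (σ 2) (σ 3) (σ 4)).im ≠ 0 := by
  have h : ∀ m i j k l : Fin 5, m ≠ i → m ≠ j → m ≠ k → m ≠ l → i ≠ j → i ≠ k → i ≠ l → j ≠ k →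
      j ≠ l → k ≠ l → ((exampleBracket m i k * exampleBracket m j l) *
        star (exampleBracket m i l * exampleBracket m j k)).im ≠ 0 := by decide +kernel
  have hσ (a b : Fin 5) (hab : a ≠ b) : σ a ≠ σ b := σ.injective.ne hab
  have key := h (σ 0) (σ 1) (σ 2) (σ 3) (σ 4) (hσ _ _ (by decide)) (hσ _ _ (by decide))
    (hσ _ _ (by decide)) (hσ _ _ (by decide)) (hσ _ _ (by decide)) (hσ _ _ (by decide))
    (hσ _ _ (by decide)) (hσ _ _ (by decide)) (hσ _ _ (by decide)) (hσ _ _ (by decide))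
  rw [crossRatioNumerator]
  simp only [bracket_exampleMatrix, ← map_mul]
  rw [← GaussianInt.toComplex_star, ← map_mul, ← GaussianInt.intCast_im]
  exact Int.cast_ne_zero.2 key

/-- The polynomial is the product, over all orders of the five lines, of the imaginary parts of the
cross-ratio numerators; the example shows that it is not zero. -/
theorem exists_mvPolynomial_isGenericPlane :
    ∃ P : MvPolynomial ((Fin 4 × Fin 3) ⊕ (Fin 4 × Fin 3)) ℝ, P ≠ 0 ∧
      ∀ M : Matrix (Fin 4) (Fin 3) ℂ,
        MvPolynomial.eval
          (Sum.elim (fun p => (M p.1 p.2).re) (fun p => (M p.1 p.2).im)) P ≠ 0 →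
        IsGenericPlane (affinePlane M) := by
  choose p q hpq using fun σ : Equiv.Perm (Fin 5) =>
    isRealPolynomial_crossRatioNumerator (σ 0) (σ 1) (σ 2) (σ 3) (σ 4)
  have heval (M : Matrix (Fin 4) (Fin 3) ℂ) :
      MvPolynomial.eval (Sum.elim (fun p => (M p.1 p.2).re) (fun p => (M p.1 p.2).im))
        (∏ σ, q σ) ≠ 0 ↔ ∀ σ : Equiv.Perm (Fin 5),
          (crossRatioNumerator M (σ 0) (σ 1) (σ 2) (σ 3) (σ 4)).im ≠ 0 := by
    rw [map_prod, Finset.prod_ne_zero_iff]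
    simp only [Finset.mem_univ, true_implies, (hpq _ M).2]
  refine ⟨∏ σ, q σ, fun h0 => ?_, fun M hM => ?_⟩
  · exact (heval exampleMatrix).2 crossRatioNumerator_exampleMatrix_im_ne_zero (by rw [h0, map_zero])
  · have h := isGenericMatrix_of_crossRatioNumerator ((heval M).1 hM)
    exact ⟨finrank_direction_affinePlane h, M, rfl, h⟩

end

theorem theorem2 :
    -- the genericity condition holds outside a proper real algebraic subset of the parameters
    (∃ P : MvPolynomial ((Fin 4 × Fin 3) ⊕ (Fin 4 × Fin 3)) ℝ, P ≠ 0 ∧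
      ∀ M : Matrix (Fin 4) (Fin 3) ℂ,
        MvPolynomial.eval
          (Sum.elim (fun p => (M p.1 p.2).re) (fun p => (M p.1 p.2).im)) P ≠ 0 →
        IsGenericPlane (affinePlane M)) ∧
    ∀ V : AffineSubspace ℂ (Fin 4 → ℂ), IsGenericPlane V →
      ∃ (Zhat : Type) (_ : TopologicalSpace Zhat)
        (ι : criticalLocus V → Zhat) (π : Zhat → criticalValues V)
        (s : Fin 5 → criticalValues V → Zhat) (e : Zhat → ℙ ℂ (Fin 5 → ℂ)),
        -- `Zhat` is a compactification of the critical locus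
        CompactSpace Zhat ∧ T2Space Zhat ∧ Topology.IsEmbedding ι ∧ DenseRange ι ∧
        -- `π` is a locally trivial circle bundle which extends the rolled coamoeba map
        Continuous π ∧
        (∀ c : criticalValues V, ∃ t : Bundle.Trivialization Circle π, c ∈ t.baseSet) ∧
        (∀ z : criticalLocus V, (π (ι z) : Fin 4 → ℙ ℝ ℂ) = rolledCoamoeba V z.1) ∧
        -- `s 0, …, s 4` are five continuous sections whose removal leaves the critical locus
        (∀ j, Continuous (s j) ∧ ∀ c, π (s j c) = c) ∧ Function.Injective s ∧
        Set.range ι = (⋃ j, Set.range (s j))ᶜ ∧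
        -- the inclusion of the critical locus in `ℂ⁴ ⊆ ℂP⁴` extends to `Zhat`, and `s j` is the
        -- section where the `j`-th homogeneous coordinate vanishes (at infinity for `j = 4`)
        Continuous e ∧ (∀ z : criticalLocus V, e (ι z) = toProj z.1.1) ∧
        ∀ j, Set.range (s j) = e ⁻¹' coordHyperplane j := by

  refine ⟨exists_mvPolynomial_isGenericPlane, ?_⟩
  rintro V ⟨hV, M, rfl, hM⟩
  replace hM : IsGenericMatrix M := hM
  have hC := hM.criticalValues_eq hV
  have : CompactSpace (criticalValues (affinePlane M)) := by
    rw [hC]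
    exact isCompact_iff_compactSpace.1 hM.isClosed_hasRealPencil.isCompact
  have hsub : ∀ c ∈ criticalValues (affinePlane M), HasRealPencil M c := fun c hc => hC.subset hc
  refine ⟨PencilSpace M (criticalValues (affinePlane M)), inferInstance, criticalInclusion hM,
    PencilSpace.proj, pencilSection hsub, fun q => projectiveMap hM q.point,
    PencilSpace.compactSpace, inferInstance, isEmbedding_criticalInclusion hM,
    hM.denseRange_criticalInclusion hV, PencilSpace.continuous_proj,
    hM.exists_trivialization hsub, fun z => rfl,
    fun j => ⟨hM.continuous_pencilSection hsub j, fun c => rfl⟩,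
    hM.pencilSection_injective hsub fun θ hθ => hC.superset hθ, ?_,
    (continuous_projectiveMap hM).comp PencilSpace.continuous_point,
    projectiveMap_criticalInclusion hM, fun j => ?_⟩
  -- Both sides are the locus where none of the five functionals vanishes.
  · ext q
    simp [hM.range_criticalInclusion hV, hM.range_pencilSection]
  · rw [hM.range_pencilSection]
    ext q
    exact (projectiveMap_mem_coordHyperplane_iff hM q.point j).symm
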